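/- Let $\Gamma$ be a discrete group acting by measure preserving transformations on a probability space $(X,\mu)$, let $\pi\colon\Gamma\to O(H)$ be an orthogonal representation on a real Hilbert space $H$ and let $b\colon\Gamma\to H$ be a 1-cocycle, i.e. $b(gh)=\pi(g)b(h)+b(g)$ for all $g,h\in\Gamma$. Put $A=L^\infty(X,\mu)$ with the action $(\sigma_g a)(x)=a(g^{-1}x)$. Fix an orthonormal basis $(e_n)_{n\in I}$ of $H$, let $(Z,\nu)=\prod_{n\in I}\bigl(\mathbb R,\tfrac1{\sqrt{2\pi}}e^{-x^2/2}dx\bigr)$, and let $\omega\colon H\to\mathcal U(L^\infty(Z,\nu))$ be the continuous extension of the map $\omega(\sum_n c_ne_n)(z)=\exp(\sqrt2\, i\sum_n c_nz_n)$ defined on finite linear combinations. Let $D=\{\omega(\xi)\mid\xi\in H\}''\subseteq L^\infty(Z,\nu)$ with the Gaussian action $\sigma_g(\omega(\xi))=\omega(\pi(g)\xi)$, and let $\tilde M=(D\bar\otimes A)\rtimes\Gamma$ be the crossed product by the diagonal action, with canonical unitaries $u_g$, trace $\tau(\sum_g x_gu_g)=\int x_e\,d(\nu\times\mu)$ and 2-norm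 $\|x\|_2=\tau(x^*x)^{1/2}$. Let $M=A\rtimes\Gamma$, identified with the von Neumann subalgebra $(1\otimes A)\rtimes\Gamma$ of $\tilde M$, and let $E_M\colon\tilde M\to M$ be the $\tau$-preserving conditional expectation. For $t\in\mathbb R$ let $\alpha_t$ be the automorphism of $\tilde M$ with $\alpha_t=\mathrm{id}$ on $D\bar\otimes A$ and $\alpha_t(u_g)=(\omega(tb(g))\otimes1)u_g$ for $g\in\Gamma$. Let $Q\subseteq M$ be a (unital) von Neumann subalgebra, let $\delta>0$ and $t\in\mathbb R$, and suppose that $\|E_M(\alpha_t(x))\|_2\ge\delta$ for every unitary $x\in Q$. Then there is a non-zero partial isometry $v\in\tilde M$ such that $\alpha_t(x)v=vx$ for all $x\in Q$. -/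

import Mathlib

open MeasureTheory ProbabilityTheory
open scoped ENNReal InnerProductSpace

noncomputable section

namespace GaussianDeformation

/-! ### Von Neumann algebras generated by a set of operators -/

section Generated

variable {K : Type*} [NormedAddCommGroup K] [InnerProductSpace ℂ K] [CompleteSpace K]

/-- The commutant of `S ∪ S*`, as a von Neumann algebra. -/
def commutantOf (S : Set (K →L[ℂ] K)) : VonNeumannAlgebra K where
  toStarSubalgebra := StarSubalgebra.centralizer ℂ S
  centralizer_centralizer' := by simp

/-- The von Neumann algebra `(S ∪ S*)''` generated by a set `S` of bounded operators. -/
def vnGenerated (S : Set (K →L[ℂ] K)) : VonNeumannAlgebra K :=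
  (commutantOf S).commutant

theorem mem_commutantOf {S : Set (K →L[ℂ] K)} {z : K →L[ℂ] K} :
    z ∈ commutantOf S ↔ ∀ s ∈ S, s * z = z * s ∧ star s * z = z * star s :=
  StarSubalgebra.mem_centralizer_iff ℂ

theorem mem_vnGenerated {S : Set (K →L[ℂ] K)} {x : K →L[ℂ] K} :
    x ∈ vnGenerated S ↔ ∀ z ∈ commutantOf S, z * x = x * z :=
  VonNeumannAlgebra.mem_commutant_iff

theorem subset_vnGenerated (S : Set (K →L[ℂ] K)) {x : K →L[ℂ] K} (hx : x ∈ S) :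
    x ∈ vnGenerated S := by
  rw [mem_vnGenerated]
  intro z hz
  exact ((mem_commutantOf.1 hz x hx).1).symm

/-- `vnGenerated S` is the smallest von Neumann algebra containing `S`. -/
theorem vnGenerated_le {S : Set (K →L[ℂ] K)} {N : VonNeumannAlgebra K}
    (h : ∀ s ∈ S, s ∈ N) : vnGenerated S ≤ N := by
  intro x hx
  rw [← VonNeumannAlgebra.commutant_commutant N, VonNeumannAlgebra.mem_commutant_iff]
  intro z hz
  rw [VonNeumannAlgebra.mem_commutant_iff] at hz
  exact mem_vnGenerated.1 hx z
    (mem_commutantOf.2 fun s hs => ⟨hz s (h s hs), hz _ (star_mem (h s hs))⟩)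

end Generated

/-! ### Multiplication operators -/

section Multiplication

variable {Y : Type*} [MeasurableSpace Y] {m : Measure Y}

/-- The operator of multiplication by `φ ∈ L^∞` on `L²`. -/
def mulOp (φ : Lp ℂ ∞ m) : Lp ℂ 2 m →L[ℂ] Lp ℂ 2 m :=
  (ContinuousLinearMap.mul ℂ ℂ).holderL m ∞ 2 2 φ

theorem coeFn_mulOp (φ : Lp ℂ ∞ m) (f : Lp ℂ 2 m) :
    mulOp φ f =ᵐ[m] fun y => φ y * f y :=
  (ContinuousLinearMap.mul ℂ ℂ).coeFn_holder φ f

theorem norm_mulOp_le (φ : Lp ℂ ∞ m) : ‖mulOp φ‖ ≤ ‖φ‖ := by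
  refine ContinuousLinearMap.opNorm_le_bound _ (norm_nonneg _) fun f => ?_
  refine ((ContinuousLinearMap.mul ℂ ℂ).norm_holder_apply_apply_le φ f).trans ?_
  have h := ContinuousLinearMap.opNorm_mul_le ℂ ℂ
  have : ‖ContinuousLinearMap.mul ℂ ℂ‖ * (‖φ‖ * ‖f‖) ≤ 1 * (‖φ‖ * ‖f‖) := by gcongr
  linarith

theorem mulOp_comp_of_ae {φ ψ χ : Lp ℂ ∞ m} (h : χ =ᵐ[m] fun y => φ y * ψ y) (f : Lp ℂ 2 m) :
    mulOp φ (mulOp ψ f) = mulOp χ f := by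
  refine Lp.ext ?_
  filter_upwards [coeFn_mulOp φ (mulOp ψ f), coeFn_mulOp ψ f, coeFn_mulOp χ f, h]
    with y h1 h2 h3 h4
  rw [h1, h2, h3, h4, mul_assoc]

theorem mulOp_comm (φ ψ : Lp ℂ ∞ m) (f : Lp ℂ 2 m) :
    mulOp φ (mulOp ψ f) = mulOp ψ (mulOp φ f) := by
  refine Lp.ext ?_
  filter_upwards [coeFn_mulOp φ (mulOp ψ f), coeFn_mulOp ψ f, coeFn_mulOp ψ (mulOp φ f),
    coeFn_mulOp φ f] with y h1 h2 h3 h4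
  rw [h1, h2, h3, h4]
  ring

theorem mulOp_eq_self {φ : Lp ℂ ∞ m} (h : φ =ᵐ[m] fun _ => 1) (f : Lp ℂ 2 m) :
    mulOp φ f = f := by
  refine Lp.ext ?_
  filter_upwards [coeFn_mulOp φ f, h] with y h1 h2
  rw [h1, h2, one_mul]

theorem inner_mulOp_of_ae {φ ψ : Lp ℂ ∞ m} (h : ψ =ᵐ[m] fun y => starRingEnd ℂ (φ y))
    (f g : Lp ℂ 2 m) : ⟪mulOp φ f, g⟫_ℂ = ⟪f, mulOp ψ g⟫_ℂ := by
  rw [L2.inner_def, L2.inner_def]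
  refine integral_congr_ae ?_
  filter_upwards [coeFn_mulOp φ f, coeFn_mulOp ψ g, h] with y h1 h2 h3
  rw [h1, h2, h3]
  simp [RCLike.inner_apply]
  ring

end Multiplication

/-! ### The Gaussian space and the exponentials `ω(ξ)` -/

section Gaussian

variable {ι : Type*}

/-- The product `(Z, ν)` of copies of `(ℝ, (2π)^{-1/2} exp(-x²/2) dx)` indexed by `ι`. -/
def gaussianProduct (ι : Type*) : Measure (ι → ℝ) :=
  Measure.infinitePi fun _ : ι => gaussianReal 0 1

instance : IsProbabilityMeasure (gaussianProduct ι) := by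
  unfold gaussianProduct; infer_instance

theorem memLp_coordinate (i : ι) : MemLp (fun z : ι → ℝ => z i) 2 (gaussianProduct ι) :=
  (memLp_id_gaussianReal' 2 (by simp)).comp_measurePreserving
    (measurePreserving_eval_infinitePi (fun _ : ι => gaussianReal 0 1) i)

/-- The coordinate function `z ↦ z i` in the real space `L²(Z, ν)`. -/
def coordinate (i : ι) : Lp ℝ 2 (gaussianProduct ι) := (memLp_coordinate i).toLp

theorem orthonormal_coordinate :
    Orthonormal ℝ (coordinate : ι → Lp ℝ 2 (gaussianProduct ι)) := by
  classical
  have hin : ∀ i j : ι, ⟪coordinate i, coordinate j⟫_ℝ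
      = ∫ z, z i * z j ∂gaussianProduct ι := by
    intro i j
    rw [L2.inner_def]
    refine integral_congr_ae ?_
    filter_upwards [(memLp_coordinate i).coeFn_toLp, (memLp_coordinate j).coeFn_toLp] with z h1 h2
    simp only [coordinate, h1, h2]
    simp [mul_comm]
  have hmp := fun i : ι => measurePreserving_eval_infinitePi (fun _ : ι => gaussianReal 0 1) i
  rw [orthonormal_iff_ite]
  intro i j
  rw [hin]
  split_ifs with hij
  · subst hij
    have h1 : ∫ z, z i * z i ∂gaussianProduct ι = ∫ x, x ^ 2 ∂gaussianReal 0 1 := by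
      have h := (hmp i).map_eq
      rw [← h, integral_map (measurable_pi_apply i).aemeasurable (by fun_prop)]
      simp [gaussianProduct, sq]
    have h2 := variance_id_gaussianReal (μ := 0) (v := 1)
    rw [variance_of_integral_eq_zero (by fun_prop) (by simp)] at h2
    rw [h1]
    simpa using h2
  · have hind : IndepFun (fun z : ι → ℝ => z i) (fun z : ι → ℝ => z j) (gaussianProduct ι) :=
      (iIndepFun_infinitePi (P := fun _ : ι => gaussianReal 0 1) (X := fun _ x => x)
        (by fun_prop)).indepFun hij
    have h3 : ∫ z, z i ∂gaussianProduct ι = 0 := by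
      have h := (hmp i).map_eq
      have h4 := integral_id_gaussianReal (μ := 0) (v := 1)
      rw [← h, integral_map (measurable_pi_apply i).aemeasurable (by fun_prop)] at h4
      simpa [gaussianProduct, Function.eval] using h4
    have h5 := hind.integral_fun_mul_eq_mul_integral
      (measurable_pi_apply i).aestronglyMeasurable (measurable_pi_apply j).aestronglyMeasurable
    rw [h5, h3, zero_mul]

variable {H : Type*} [NormedAddCommGroup H] [InnerProductSpace ℝ H]

/-- The isometric embedding `H → L²(Z, ν)` with `∑ cₙ eₙ ↦ (z ↦ ∑ cₙ zₙ)`. -/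
def gaussianField (e : HilbertBasis ι ℝ H) : H →ₗᵢ[ℝ] Lp ℝ 2 (gaussianProduct ι) :=
  (orthonormal_coordinate (ι := ι)).orthogonalFamily.linearIsometry.comp
    e.repr.toLinearIsometry

theorem gaussianField_basis (e : HilbertBasis ι ℝ H) (i : ι) :
    gaussianField e (e i) = coordinate i := by
  classical
  simp [gaussianField, e.repr_self, OrthogonalFamily.linearIsometry_apply_single]

/-- The function `exp(√2 i ∑ cₙ zₙ)` associated with the vector `ξ = ∑ cₙ eₙ`. -/
def omegaFun (e : HilbertBasis ι ℝ H) (ξ : H) (z : ι → ℝ) : ℂ :=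
  Complex.exp (((√2 * gaussianField e ξ z : ℝ) : ℂ) * Complex.I)

theorem memLp_omegaFun (e : HilbertBasis ι ℝ H) (ξ : H) :
    MemLp (omegaFun e ξ) ∞ (gaussianProduct ι) := by
  refine memLp_top_of_bound ?_ 1 (.of_forall fun z => (Complex.norm_exp_ofReal_mul_I _).le)
  have h := (Lp.aestronglyMeasurable (gaussianField e ξ)).const_mul √2
  exact Complex.continuous_exp.comp_aestronglyMeasurable
    ((Complex.continuous_ofReal.comp_aestronglyMeasurable h).mul_const Complex.I)

/-- The unitary `ω(ξ) ∈ L^∞(Z, ν)`; the map `ω` is the continuous extension to `H` of the map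
`∑ cₙ eₙ ↦ (z ↦ exp(√2 i ∑ cₙ zₙ))` on finite linear combinations of the basis. -/
def omega (e : HilbertBasis ι ℝ H) (ξ : H) : Lp ℂ ∞ (gaussianProduct ι) :=
  (memLp_omegaFun e ξ).toLp

theorem coeFn_omega (e : HilbertBasis ι ℝ H) (ξ : H) :
    omega e ξ =ᵐ[gaussianProduct ι] omegaFun e ξ :=
  (memLp_omegaFun e ξ).coeFn_toLp

theorem norm_omega_le (e : HilbertBasis ι ℝ H) (ξ : H) : ‖omega e ξ‖ ≤ 1 := by
  refine Lp.norm_le_of_ae_bound zero_le_one ?_ |>.trans (by simp)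
  filter_upwards [coeFn_omega e ξ] with z hz
  rw [hz]
  exact (Complex.norm_exp_ofReal_mul_I _).le

theorem omega_add (e : HilbertBasis ι ℝ H) (ξ η : H) :
    omega e (ξ + η) =ᵐ[gaussianProduct ι] fun z => omega e ξ z * omega e η z := by
  filter_upwards [coeFn_omega e (ξ + η), coeFn_omega e ξ, coeFn_omega e η,
    Lp.coeFn_add (gaussianField e ξ) (gaussianField e η)] with z h1 h2 h3 h4
  rw [h1, h2, h3, omegaFun, omegaFun, omegaFun, map_add, h4, ← Complex.exp_add]
  congr 1
  simp only [Pi.add_apply]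
  push_cast
  ring

theorem omega_zero (e : HilbertBasis ι ℝ H) :
    omega e 0 =ᵐ[gaussianProduct ι] fun _ => 1 := by
  filter_upwards [coeFn_omega e 0, Lp.coeFn_zero ℝ 2 (gaussianProduct ι)] with z h1 h2
  rw [h1, omegaFun, map_zero, h2]
  simp

theorem omega_neg (e : HilbertBasis ι ℝ H) (ξ : H) :
    omega e (-ξ) =ᵐ[gaussianProduct ι] fun z => starRingEnd ℂ (omega e ξ z) := by
  filter_upwards [coeFn_omega e (-ξ), coeFn_omega e ξ,
    Lp.coeFn_neg (gaussianField e ξ)] with z h1 h2 h3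
  rw [h1, h2, omegaFun, omegaFun, map_neg, h3, ← Complex.exp_conj]
  congr 1
  simp

end Gaussian

/-! ### The algebras `M ⊆ M̃` -/

section Construction

variable {Γ ι H X : Type*} [NormedAddCommGroup H] [InnerProductSpace ℝ H] [MeasurableSpace X]

/-- The Hilbert space `ℓ²(Γ) ⊗ L²(Z × X, ν × μ) = ℓ²(Γ, L²(Z × X))` on which
`M̃ = (D ⊗ A) ⋊ Γ` acts by the regular representation of the crossed product. -/
abbrev Space (Γ ι : Type*) {X : Type*} [MeasurableSpace X] (μ : Measure X) : Type _ :=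
  lp (fun _ : Γ => Lp ℂ 2 ((gaussianProduct ι).prod μ)) 2

/-- The bounded operators on `ℓ²(Γ, L²(Z × X))`. -/
abbrev Op (Γ ι : Type*) {X : Type*} [MeasurableSpace X] (μ : Measure X) : Type _ :=
  Space Γ ι μ →L[ℂ] Space Γ ι μ

variable (μ : Measure X)

/-- The diagonal operator `(φ f)(g) = φ_g · f(g)` for a bounded family `φ_g ∈ L^∞(Z × X)`. -/
def diagOp (φ : Γ → Lp ℂ ∞ ((gaussianProduct ι).prod μ)) {C : ℝ} (hC : 0 ≤ C)
    (hφ : ∀ g, ‖φ g‖ ≤ C) : Op Γ ι μ :=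
  lp.mapCLM 2 (fun g => mulOp (φ g)) hC fun g => (norm_mulOp_le (φ g)).trans (hφ g)

@[simp]
theorem diagOp_apply (φ : Γ → Lp ℂ ∞ ((gaussianProduct ι).prod μ)) {C : ℝ} (hC : 0 ≤ C)
    (hφ : ∀ g, ‖φ g‖ ≤ C) (f : Space Γ ι μ) (g : Γ) :
    diagOp μ φ hC hφ f g = mulOp (φ g) (f g) := rfl

variable [Group Γ]

theorem memlp_shift (h : Γ) (f : Space Γ ι μ) :
    Memℓp (fun g => f (h⁻¹ * g)) 2 := by
  have hf := (lp.memℓp f).summable (by norm_num)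
  refine memℓp_gen ?_
  exact (Equiv.mulLeft h⁻¹).summable_iff.2 hf

/-- The canonical unitary `u_h` of the crossed product: `(u_h f)(g) = f(h⁻¹ g)`. -/
def groupUnitary (ι : Type*) (h : Γ) : Op Γ ι μ :=
  LinearMap.mkContinuous
    { toFun := fun f => (⟨fun g => f (h⁻¹ * g), memlp_shift μ h f⟩ : Space Γ ι μ)
      map_add' := fun _ _ => by ext1; rfl
      map_smul' := fun _ _ => by ext1; rfl } 1 fun f => by
    rw [one_mul]
    refine le_of_eq ?_
    rw [lp.norm_eq_tsum_rpow (by norm_num), lp.norm_eq_tsum_rpow (by norm_num)]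
    congr 1
    exact (Equiv.mulLeft h⁻¹).tsum_eq (fun g => ‖f g‖ ^ (2 : ℝ≥0∞).toReal)

@[simp]
theorem groupUnitary_apply (h : Γ) (f : Space Γ ι μ) (g : Γ) :
    groupUnitary μ ι h f g = f (h⁻¹ * g) := rfl

section Base

variable [IsProbabilityMeasure μ]

/-- `ω(ξ) ⊗ 1 ∈ L^∞(Z × X)`. -/
def omegaTensorOne (e : HilbertBasis ι ℝ H) (ξ : H) : Lp ℂ ∞ ((gaussianProduct ι).prod μ) :=
  Lp.compMeasurePreserving Prod.fst measurePreserving_fst (omega e ξ)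

/-- `1 ⊗ a ∈ L^∞(Z × X)`. -/
def oneTensor (ι : Type*) (a : Lp ℂ ∞ μ) : Lp ℂ ∞ ((gaussianProduct ι).prod μ) :=
  Lp.compMeasurePreserving Prod.snd measurePreserving_snd a

theorem norm_omegaTensorOne_le (e : HilbertBasis ι ℝ H) (ξ : H) :
    ‖omegaTensorOne μ e ξ‖ ≤ 1 := by
  rw [omegaTensorOne, Lp.norm_compMeasurePreserving]
  exact norm_omega_le e ξ

theorem coeFn_omegaTensorOne (e : HilbertBasis ι ℝ H) (ξ : H) :
    omegaTensorOne μ e ξ =ᵐ[(gaussianProduct ι).prod μ] fun y => omega e ξ y.1 :=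
  Lp.coeFn_compMeasurePreserving _ _

theorem omegaTensorOne_add (e : HilbertBasis ι ℝ H) (ξ η : H) :
    omegaTensorOne μ e (ξ + η) =ᵐ[(gaussianProduct ι).prod μ]
      fun y => omegaTensorOne μ e ξ y * omegaTensorOne μ e η y := by
  filter_upwards [coeFn_omegaTensorOne μ e (ξ + η), coeFn_omegaTensorOne μ e ξ,
    coeFn_omegaTensorOne μ e η, (measurePreserving_fst (μ := gaussianProduct ι)
      (ν := μ)).quasiMeasurePreserving.ae (omega_add e ξ η)] with y h1 h2 h3 h4
  rw [h1, h2, h3, h4]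

theorem omegaTensorOne_zero (e : HilbertBasis ι ℝ H) :
    omegaTensorOne μ e 0 =ᵐ[(gaussianProduct ι).prod μ] fun _ => 1 := by
  filter_upwards [coeFn_omegaTensorOne μ e 0, (measurePreserving_fst (μ := gaussianProduct ι)
      (ν := μ)).quasiMeasurePreserving.ae (omega_zero e)] with y h1 h2
  rw [h1, h2]

theorem omegaTensorOne_neg (e : HilbertBasis ι ℝ H) (ξ : H) :
    omegaTensorOne μ e (-ξ) =ᵐ[(gaussianProduct ι).prod μ]
      fun y => starRingEnd ℂ (omegaTensorOne μ e ξ y) := by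
  filter_upwards [coeFn_omegaTensorOne μ e (-ξ), coeFn_omegaTensorOne μ e ξ,
    (measurePreserving_fst (μ := gaussianProduct ι)
      (ν := μ)).quasiMeasurePreserving.ae (omega_neg e ξ)] with y h1 h2 h3
  rw [h1, h2, h3]

/-- The operator of `ω(ξ) ⊗ 1 ∈ D ⊗ A` in the crossed product. For the Gaussian action
`σ_g(ω(ξ)) = ω(π(g) ξ)` it is `(x f)(g) = σ_{g⁻¹}(x) f(g)` with `x = ω(ξ) ⊗ 1`. -/
def omegaOp (e : HilbertBasis ι ℝ H) (π : Γ →* (H ≃ₗᵢ[ℝ] H)) (ξ : H) : Op Γ ι μ :=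
  diagOp μ (fun g => omegaTensorOne μ e (π g⁻¹ ξ)) zero_le_one
    fun _ => norm_omegaTensorOne_le μ e _

variable [MulAction Γ X] [MeasurableConstSMul Γ X] [SMulInvariantMeasure Γ X μ]

/-- The action `(σ_g a)(x) = a(g⁻¹ x)` of `Γ` on `A = L^∞(X, μ)`. -/
def translate (g : Γ) (a : Lp ℂ ∞ μ) : Lp ℂ ∞ μ :=
  Lp.compMeasurePreserving (fun x => g⁻¹ • x) (measurePreserving_smul g⁻¹ μ) a

/-- The operator of `1 ⊗ a ∈ D ⊗ A` in the crossed product: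
`(x f)(g) = σ_{g⁻¹}(x) f(g)` with `x = 1 ⊗ a`. -/
def functionOp (Γ ι : Type*) [Group Γ] [MulAction Γ X] [MeasurableConstSMul Γ X]
    [SMulInvariantMeasure Γ X μ] (a : Lp ℂ ∞ μ) : Op Γ ι μ :=
  diagOp μ (fun g => oneTensor μ ι (translate μ g⁻¹ a)) (norm_nonneg a) fun g => by
    rw [oneTensor, translate, Lp.norm_compMeasurePreserving, Lp.norm_compMeasurePreserving]

/-- The von Neumann algebra `D ⊗ A` inside the crossed product `M̃`: it is generated by the
elements `ω(ξ) ⊗ 1` and `1 ⊗ a`, because `D` is generated by the `ω(ξ)`, `ξ ∈ H`, and because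
`x ↦ (σ_{g⁻¹}(x))_g` is a normal faithful representation of `D ⊗ A`. -/
def baseAlgebra (e : HilbertBasis ι ℝ H) (π : Γ →* (H ≃ₗᵢ[ℝ] H)) :
    VonNeumannAlgebra (Space Γ ι μ) :=
  vnGenerated (Set.range (omegaOp μ e π) ∪ Set.range (functionOp μ Γ ι))

/-- The crossed product `M̃ = (D ⊗ A) ⋊ Γ`, generated by `D ⊗ A` and the unitaries `u_g`. -/
def bigAlgebra (e : HilbertBasis ι ℝ H) (π : Γ →* (H ≃ₗᵢ[ℝ] H)) :
    VonNeumannAlgebra (Space Γ ι μ) :=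
  vnGenerated ((baseAlgebra μ e π : Set (Op Γ ι μ)) ∪ Set.range (groupUnitary μ ι))

/-- The crossed product `M = A ⋊ Γ`, identified with the von Neumann subalgebra `(1 ⊗ A) ⋊ Γ` of
`M̃` generated by `1 ⊗ A` and the unitaries `u_g`. -/
def smallAlgebra (Γ ι : Type*) [Group Γ] [MulAction Γ X] [MeasurableConstSMul Γ X]
    [SMulInvariantMeasure Γ X μ] : VonNeumannAlgebra (Space Γ ι μ) :=
  vnGenerated (Set.range (functionOp μ Γ ι) ∪ Set.range (groupUnitary μ ι))

end Base

/-! ### The trace, the 2-norm and conditional expectations -/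

section Trace

variable {μ}

open Classical in
/-- The vector `δ_e ⊗ 1`, which implements the trace of `M̃`. -/
def traceVector (Γ ι : Type*) [Group Γ] (μ : Measure X) [IsProbabilityMeasure μ] :
    Space Γ ι μ :=
  lp.single 2 (1 : Γ) (Lp.const 2 ((gaussianProduct ι).prod μ) (1 : ℂ))

variable [IsProbabilityMeasure μ]

/-- The trace `τ(∑_g x_g u_g) = ∫ x_e d(ν × μ)` of `M̃`. -/
def trace (x : Op Γ ι μ) : ℂ := ⟪traceVector Γ ι μ, x (traceVector Γ ι μ)⟫_ℂ

/-- The 2-norm `‖x‖₂ = τ(x* x)^{1/2}`. -/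
def norm2 (x : Op Γ ι μ) : ℝ := √(trace (star x * x)).re

open Classical in
/-- The trace preserving conditional expectation `E_N` of `M̃` onto a von Neumann subalgebra `N`:
for `x ∈ M̃`, `E_N(x)` is the unique `y ∈ N` such that `τ(n y) = τ(n x)` for all `n ∈ N`. -/
def condExp (N : VonNeumannAlgebra (Space Γ ι μ)) (x : Op Γ ι μ) : Op Γ ι μ :=
  if h : ∃ y ∈ N, ∀ n ∈ N, trace (n * y) = trace (n * x) then h.choose else 0

end Trace

/-! ### The deformation `α_t` -/

section Deformation

variable [IsProbabilityMeasure μ]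

/-- The diagonal operator `(V_t f)(g) = (ω(-t b(g⁻¹)) ⊗ 1) f(g)`. -/
def deformationOp (e : HilbertBasis ι ℝ H) (b : Γ → H) (t : ℝ) : Op Γ ι μ :=
  diagOp μ (fun g => omegaTensorOne μ e (-(t • b g⁻¹))) zero_le_one
    fun _ => norm_omegaTensorOne_le μ e _

theorem star_deformationOp (e : HilbertBasis ι ℝ H) (b : Γ → H) (t : ℝ) :
    star (deformationOp μ e b t) = deformationOp μ e b (-t) := by
  rw [ContinuousLinearMap.star_eq_adjoint, eq_comm, ContinuousLinearMap.eq_adjoint_iff]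
  intro f f'
  rw [lp.inner_eq_tsum, lp.inner_eq_tsum]
  congr 1
  ext g
  refine inner_mulOp_of_ae ?_ _ _
  have h := omegaTensorOne_neg μ e (-(-t • b g⁻¹))
  convert h using 3
  simp

theorem deformationOp_mul_neg (e : HilbertBasis ι ℝ H) (b : Γ → H) (t : ℝ) :
    deformationOp μ e b t * deformationOp μ e b (-t) = 1 := by
  ext1 f
  refine lp.ext (funext fun g => ?_)
  change mulOp _ (mulOp _ (f g)) = f g
  have h := omegaTensorOne_add μ e (-(t • b g⁻¹)) (-(-t • b g⁻¹))
  rw [mulOp_comp_of_ae h]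
  refine mulOp_eq_self ?_ _
  simpa using omegaTensorOne_zero μ e

theorem deformationOp_mem_unitary (e : HilbertBasis ι ℝ H) (b : Γ → H) (t : ℝ) :
    deformationOp μ e b t ∈ unitary (Op Γ ι μ) := by
  rw [Unitary.mem_iff, star_deformationOp]
  exact ⟨by simpa using deformationOp_mul_neg μ e b (-t), deformationOp_mul_neg μ e b t⟩

theorem deformationOp_commute_diagOp (e : HilbertBasis ι ℝ H) (b : Γ → H) (t : ℝ)
    (φ : Γ → Lp ℂ ∞ ((gaussianProduct ι).prod μ)) {C : ℝ} (hC : 0 ≤ C) (hφ : ∀ g, ‖φ g‖ ≤ C) :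
    diagOp μ φ hC hφ * deformationOp μ e b t = deformationOp μ e b t * diagOp μ φ hC hφ := by
  ext1 f
  exact lp.ext (funext fun g => mulOp_comm _ _ _)

/-- The deformation `α_t`, realised as conjugation by the unitary `V_t`. It maps `M̃` onto `M̃`
(`deformation_mem_iff`), and on `M̃` it is the automorphism with
`α_t = id` on `D ⊗ A` (`deformation_of_mem_base`) and
`α_t(u_g) = (ω(t b(g)) ⊗ 1) u_g` (`deformation_groupUnitary`). -/
def deformation (e : HilbertBasis ι ℝ H) (b : Γ → H) (t : ℝ) : Op Γ ι μ ≃⋆ₐ[ℂ] Op Γ ι μ :=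
  Unitary.conjStarAlgAut ℂ (Op Γ ι μ) ⟨deformationOp μ e b t, deformationOp_mem_unitary μ e b t⟩

theorem deformation_apply (e : HilbertBasis ι ℝ H) (b : Γ → H) (t : ℝ) (x : Op Γ ι μ) :
    deformation μ e b t x = deformationOp μ e b t * x * deformationOp μ e b (-t) := by
  rw [← star_deformationOp]
  rfl

theorem deformation_neg_deformation (e : HilbertBasis ι ℝ H) (b : Γ → H) (t : ℝ) (x : Op Γ ι μ) :
    deformation μ e b (-t) (deformation μ e b t x) = x := by
  have h := deformationOp_mul_neg μ e b (-t)
  rw [neg_neg] at h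
  simp only [deformation_apply, neg_neg]
  calc _ = (deformationOp μ e b (-t) * deformationOp μ e b t) * x *
        (deformationOp μ e b (-t) * deformationOp μ e b t) := by simp only [mul_assoc]
    _ = x := by rw [h, one_mul, mul_one]

/-- Covariance on `D`: `u_h (ω(ξ) ⊗ 1) u_h* = ω(π(h) ξ) ⊗ 1`. -/
theorem groupUnitary_mul_omegaOp (e : HilbertBasis ι ℝ H) (π : Γ →* (H ≃ₗᵢ[ℝ] H)) (h : Γ)
    (ξ : H) : groupUnitary μ ι h * omegaOp μ e π ξ =
      omegaOp μ e π (π h ξ) * groupUnitary μ ι h := by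
  ext1 f
  refine lp.ext (funext fun g => ?_)
  change mulOp (omegaTensorOne μ e (π (h⁻¹ * g)⁻¹ ξ)) (f (h⁻¹ * g)) =
    mulOp (omegaTensorOne μ e (π g⁻¹ (π h ξ))) (f (h⁻¹ * g))
  have : π (h⁻¹ * g)⁻¹ ξ = π g⁻¹ (π h ξ) := by
    rw [mul_inv_rev, inv_inv, map_mul]
    rfl
  rw [this]

theorem deformation_groupUnitary (e : HilbertBasis ι ℝ H) (π : Γ →* (H ≃ₗᵢ[ℝ] H)) (b : Γ → H)
    (hb : ∀ g h, b (g * h) = π g (b h) + b g) (t : ℝ) (h : Γ) :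
    deformation μ e b t (groupUnitary μ ι h) =
      omegaOp μ e π (t • b h) * groupUnitary μ ι h := by
  rw [deformation_apply]
  ext1 f
  refine lp.ext (funext fun g => ?_)
  change mulOp (omegaTensorOne μ e (-(t • b g⁻¹)))
      (mulOp (omegaTensorOne μ e (-(-t • b (h⁻¹ * g)⁻¹))) (f (h⁻¹ * g))) =
    mulOp (omegaTensorOne μ e (π g⁻¹ (t • b h))) (f (h⁻¹ * g))
  rw [mulOp_comp_of_ae (omegaTensorOne_add μ e _ _)]
  congr 3
  rw [mul_inv_rev, inv_inv, hb, map_smul, smul_add, neg_smul, neg_smul, neg_add, neg_neg, neg_neg]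
  abel

variable [MulAction Γ X] [MeasurableConstSMul Γ X] [SMulInvariantMeasure Γ X μ]

/-- Covariance on `A`: `u_h (1 ⊗ a) u_h* = 1 ⊗ σ_h(a)`. -/
theorem groupUnitary_mul_functionOp (h : Γ) (a : Lp ℂ ∞ μ) :
    groupUnitary μ ι h * functionOp μ Γ ι a =
      functionOp μ Γ ι (translate μ h a) * groupUnitary μ ι h := by
  ext1 f
  refine lp.ext (funext fun g => ?_)
  change mulOp (oneTensor μ ι (translate μ (h⁻¹ * g)⁻¹ a)) (f (h⁻¹ * g)) =
    mulOp (oneTensor μ ι (translate μ g⁻¹ (translate μ h a))) (f (h⁻¹ * g))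
  have : translate μ (h⁻¹ * g)⁻¹ a = translate μ g⁻¹ (translate μ h a) := by
    rw [translate, translate, translate, ← Lp.compMeasurePreserving_comp_apply]
    congr 2
    ext x
    simp [mul_smul]
  rw [this]

theorem functionOp_mem_smallAlgebra (a : Lp ℂ ∞ μ) :
    functionOp μ Γ ι a ∈ smallAlgebra μ Γ ι :=
  subset_vnGenerated _ (.inl ⟨a, rfl⟩)

theorem groupUnitary_mem_smallAlgebra (h : Γ) : groupUnitary μ ι h ∈ smallAlgebra μ Γ ι :=
  subset_vnGenerated _ (.inr ⟨h, rfl⟩)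

theorem smallAlgebra_le_bigAlgebra (e : HilbertBasis ι ℝ H) (π : Γ →* (H ≃ₗᵢ[ℝ] H)) :
    smallAlgebra μ Γ ι ≤ bigAlgebra μ e π := by
  refine vnGenerated_le ?_
  rintro _ (⟨a, rfl⟩ | ⟨h, rfl⟩)
  · exact subset_vnGenerated _ (.inl (subset_vnGenerated _ (.inr ⟨a, rfl⟩)))
  · exact subset_vnGenerated _ (.inr ⟨h, rfl⟩)

/-- `α_t` is the identity on `D ⊗ A`. -/
theorem deformation_of_mem_base (e : HilbertBasis ι ℝ H) (π : Γ →* (H ≃ₗᵢ[ℝ] H)) (b : Γ → H)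
    (t : ℝ) {x : Op Γ ι μ} (hx : x ∈ baseAlgebra μ e π) : deformation μ e b t x = x := by
  have key : ∀ s : ℝ, ∀ y ∈ Set.range (omegaOp μ e π) ∪ Set.range (functionOp μ Γ ι),
      y * deformationOp μ e b s = deformationOp μ e b s * y := by
    rintro s _ (⟨ξ, rfl⟩ | ⟨a, rfl⟩)
    · exact deformationOp_commute_diagOp μ e b s _ _ _
    · exact deformationOp_commute_diagOp μ e b s _ _ _
  have hV : deformationOp μ e b t ∈
      commutantOf (Set.range (omegaOp μ e π) ∪ Set.range (functionOp μ Γ ι)) := by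
    refine mem_commutantOf.2 fun s hs => ⟨key t s hs, ?_⟩
    have h := congrArg star (key (-t) s hs)
    rw [star_mul, star_mul, star_deformationOp, neg_neg] at h
    exact h.symm
  rw [deformation_apply, mem_vnGenerated.1 hx _ hV, mul_assoc, deformationOp_mul_neg, mul_one]

theorem deformation_mem (e : HilbertBasis ι ℝ H) (π : Γ →* (H ≃ₗᵢ[ℝ] H)) (b : Γ → H)
    (hb : ∀ g h, b (g * h) = π g (b h) + b g) (t : ℝ) {x : Op Γ ι μ}
    (hx : x ∈ bigAlgebra μ e π) : deformation μ e b t x ∈ bigAlgebra μ e π := by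
  have hgen : ∀ y ∈ (baseAlgebra μ e π : Set (Op Γ ι μ)) ∪ Set.range (groupUnitary μ ι),
      deformation μ e b t y ∈ bigAlgebra μ e π := by
    rintro _ (hy | ⟨h, rfl⟩)
    · rw [deformation_of_mem_base μ e π b t hy]
      exact subset_vnGenerated _ (.inl hy)
    · rw [deformation_groupUnitary μ e π b hb]
      exact mul_mem (subset_vnGenerated _ (.inl (subset_vnGenerated _ (.inl ⟨_, rfl⟩))))
        (subset_vnGenerated _ (.inr ⟨h, rfl⟩))
  refine mem_vnGenerated.2 fun z hz => ?_
  have hz' : deformation μ e b (-t) z ∈ commutantOf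
      ((baseAlgebra μ e π : Set (Op Γ ι μ)) ∪ Set.range (groupUnitary μ ι)) := by
    refine mem_commutantOf.2 fun s hs => ?_
    have h1 := mem_vnGenerated.1 (hgen s hs) z hz
    have h2 := mem_vnGenerated.1 (star_mem (hgen s hs)) z hz
    rw [← map_star] at h2
    have h1' := congrArg (deformation μ e b (-t)) h1
    have h2' := congrArg (deformation μ e b (-t)) h2
    simp only [map_mul, deformation_neg_deformation] at h1' h2'
    exact ⟨h1'.symm, h2'.symm⟩
  have h := congrArg (deformation μ e b t) (mem_vnGenerated.1 hx _ hz')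
  have hinv := deformation_neg_deformation μ e b (-t) z
  rw [neg_neg] at hinv
  simpa only [map_mul, hinv] using h

/-- `α_t` restricts to an automorphism of `M̃`. -/
theorem deformation_mem_iff (e : HilbertBasis ι ℝ H) (π : Γ →* (H ≃ₗᵢ[ℝ] H)) (b : Γ → H)
    (hb : ∀ g h, b (g * h) = π g (b h) + b g) (t : ℝ) {x : Op Γ ι μ} :
    deformation μ e b t x ∈ bigAlgebra μ e π ↔ x ∈ bigAlgebra μ e π := by
  refine ⟨fun h => ?_, deformation_mem μ e π b hb t⟩
  have := deformation_mem μ e π b hb (-t) h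
  rwa [deformation_neg_deformation] at this

end Deformation

end Construction

end GaussianDeformation

end

noncomputable section

namespace GaussianDeformation

/-! ### Polar decomposition and spanning by unitaries -/

section OperatorAlgebra

variable {K : Type*} [NormedAddCommGroup K] [InnerProductSpace ℂ K] [CompleteSpace K]

/-! Let `Ω` be the trace vector and `x` a unitary of `Q` with Fourier coefficients `a_g`. Since `∫
ω(ξ) = exp(-‖ξ‖²)` (`integral_omega`), passing from `x` to `E_M(α_t(x))` multiplies `a_g` by `c_g =
exp(-t²‖b(g)‖²)`, which lies in `(0, 1]`. Hence `‖E_M(α_t(x))‖₂² = ∑ c_g² ‖a_g‖² ≤ ∑ c_g ‖a_g‖² =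
τ(x* α_t(x))`, and the hypothesis gives `Re τ(α_t(x) x*) ≥ δ²` for all unitaries of `Q`. The
estimate is `norm2_condExp_le`; it uses only the defining property of `E_M` and an
arithmetic-geometric inequality on each fibre.

The rest is Popa's convexity argument (`exists_intertwiner_of_inner_ge`). In the closed convex hull
of the vectors `α_t(x) x* Ω`, the vector `ζ` of minimal norm is unique. It is bounded with respect
to the commutant, so `ζ = yΩ` with `y ∈ M̃`. The maps `a ↦ α_t(x) a x*` preserve the hull and the
2-norm, so uniqueness gives `α_t(x) y x* = y`. The lower bound survives in the hull, so `y ≠ 0`. The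
partial isometry in the polar decomposition of `y` is the required `v`.

This argument needs `Ω` to be separating and tracial for `M̃` (`dense_commutant_traceVector`,
`norm_star_apply_traceVector`). Both facts come from explicit elements of the commutant:
multiplication by a fixed function of `L^∞(Z × X)`, and right translation on `Γ` twisted by the
diagonal action. The twist requires the Gaussian action to be realised by measure preserving maps of
`Z`, which is `gaussianMap`. -/

theorem norm_cfcAbs_apply (y : K →L[ℂ] K) (ζ : K) : ‖CFC.abs y ζ‖ = ‖y ζ‖ := by
  have hsa : star (CFC.abs y) = CFC.abs y := (CFC.abs_nonneg y).isSelfAdjoint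
  have h1 : ⟪CFC.abs y ζ, CFC.abs y ζ⟫_ℂ = ⟪y ζ, y ζ⟫_ℂ := by
    calc ⟪CFC.abs y ζ, CFC.abs y ζ⟫_ℂ = ⟪ζ, (star (CFC.abs y) * CFC.abs y) ζ⟫_ℂ := by
          rw [ContinuousLinearMap.star_eq_adjoint, mul_apply_eq_comp,
            ContinuousLinearMap.adjoint_inner_right]
      _ = ⟪y ζ, y ζ⟫_ℂ := by
          rw [hsa, CFC.abs_mul_abs, ContinuousLinearMap.star_eq_adjoint,
            mul_apply_eq_comp, ContinuousLinearMap.adjoint_inner_right]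
  rw [inner_self_eq_norm_sq_to_K, inner_self_eq_norm_sq_to_K] at h1
  have h2 : ‖CFC.abs y ζ‖ ^ 2 = ‖y ζ‖ ^ 2 := by exact_mod_cast h1
  exact (sq_eq_sq₀ (norm_nonneg _) (norm_nonneg _)).1 h2

/-- The partial isometry of the polar decomposition of a bounded operator `y`. It intertwines
everything which `y` intertwines together with the adjoints. -/
theorem exists_polar_partialIsometry (y : K →L[ℂ] K) :
    ∃ v : K →L[ℂ] K, v * star v * v = v ∧ v * CFC.abs y = y ∧
      ∀ a c : K →L[ℂ] K, a * y = y * c → star a * y = y * star c → a * v = v * c := by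
  set p := CFC.abs y with hp
  have hsa : star p = p := (CFC.abs_nonneg y).isSelfAdjoint
  let S : Submodule ℂ K := (LinearMap.range (p : K →ₗ[ℂ] K)).topologicalClosure
  have hmem : ∀ ζ, p ζ ∈ S := fun ζ =>
    Submodule.le_topologicalClosure _ ⟨ζ, rfl⟩
  let e : K →ₗ[ℂ] S := (p : K →ₗ[ℂ] K).codRestrict S hmem
  have hde : DenseRange e := by
    intro x
    rw [closure_subtype]
    have hx := x.2
    change (x : K) ∈ closure _ at hx
    refine closure_mono ?_ hx
    rintro _ ⟨ζ, rfl⟩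
    exact ⟨e ζ, ⟨ζ, rfl⟩, rfl⟩
  have hbd : ∀ ζ, ‖(y : K →ₗ[ℂ] K) ζ‖ ≤ 1 * ‖e ζ‖ := fun ζ => by
    rw [one_mul]
    exact (norm_cfcAbs_apply y ζ).ge
  -- Because `‖yζ‖ = ‖pζ‖`, the assignment `pζ ↦ yζ` is well defined and isometric on the range of
  -- `p`, hence extends to its closure `S`.
  let w : S →L[ℂ] K := (y : K →ₗ[ℂ] K).extendOfNorm e
  have hw : ∀ ζ, w (e ζ) = y ζ := LinearMap.extendOfNorm_eq hde ⟨1, hbd⟩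
  have : CompleteSpace S := (Submodule.isClosed_topologicalClosure _).completeSpace_coe
  have hwn : ∀ x : S, ‖w x‖ = ‖x‖ := by
    intro x
    refine hde.induction_on (p := fun x => ‖w x‖ = ‖x‖) x
      (isClosed_eq (by fun_prop) (by fun_prop)) fun ζ => ?_
    rw [hw]
    exact (norm_cfcAbs_apply y ζ).symm
  let P : K →L[ℂ] S := S.orthogonalProjectionOnto
  let v : K →L[ℂ] K := w.comp P
  have hvp : ∀ ζ, v (p ζ) = y ζ := fun ζ => by
    have : P (p ζ) = e ζ := S.orthogonalProjectionOnto_mem_subspace_eq_self (e ζ)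
    change w (P (p ζ)) = _
    rw [this, hw]
  have hv0 : ∀ ζ, p ζ = 0 → v ζ = 0 := fun ζ hζ => by
    have : P ζ = 0 := by
      rw [Submodule.orthogonalProjectionOnto_eq_zero_iff, Submodule.orthogonal_closure]
      rw [Submodule.mem_orthogonal]
      rintro _ ⟨η, rfl⟩
      change ⟪p η, ζ⟫_ℂ = 0
      rw [← hsa, ContinuousLinearMap.star_eq_adjoint, ContinuousLinearMap.adjoint_inner_left, hζ,
        inner_zero_right]
    change w (P ζ) = 0
    rw [this, map_zero]
  -- `K = S ⊕ Sᗮ`, and `Sᗮ` lies in the kernel of the self-adjoint `p`; so identities between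
  -- operators need checking only on the range and the kernel of `p`.
  have hzero : ∀ D : K →L[ℂ] K, (∀ ζ, D (p ζ) = 0) → (∀ ζ, p ζ = 0 → D ζ = 0) → D = 0 := by
    intro D h1 h2
    have h3 : ∀ x : S, D x = 0 := fun x =>
      hde.induction_on (p := fun x : S => D x = 0) x (isClosed_eq (by fun_prop) (by fun_prop)) h1
    ext ζ
    have h4 : p (ζ - P ζ) = 0 := by
      have h5 : ζ - P ζ ∈ Sᗮ := S.sub_starProjection_mem_orthogonal ζ
      refine ext_inner_left ℂ fun η => ?_
      rw [inner_zero_right, ← hsa, ContinuousLinearMap.star_eq_adjoint,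
        ContinuousLinearMap.adjoint_inner_right]
      exact (Submodule.mem_orthogonal _ _).1 h5 _ (hmem η)
    have h6 := h2 _ h4
    rw [map_sub, h3, sub_zero] at h6
    simpa using h6
  refine ⟨v, ?_, ContinuousLinearMap.ext hvp, ?_⟩
  · have key : star v * v * p = p := by
      ext ζ
      refine ext_inner_left ℂ fun η => ?_
      have hisom : ∀ a b, ⟪v (a : K), v (b : K)⟫_ℂ = ⟪(P a : K), (P b : K)⟫_ℂ := by
        intro a b
        let W : S →ₗᵢ[ℂ] K := ⟨w, hwn⟩
        exact W.inner_map_map _ _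
      change ⟪η, (star v) (v (p ζ))⟫_ℂ = _
      rw [ContinuousLinearMap.star_eq_adjoint, ContinuousLinearMap.adjoint_inner_right, hisom]
      have : P (p ζ) = e ζ := S.orthogonalProjectionOnto_mem_subspace_eq_self (e ζ)
      rw [this]
      exact S.inner_orthogonalProjectionOnto_eq_of_mem_right (e ζ) η
    have := hzero (v * star v * v - v) (fun ζ => ?_) (fun ζ hζ => ?_)
    · exact sub_eq_zero.1 this
    · have h := congrArg (fun T : K →L[ℂ] K => v (T ζ)) key
      simp only [mul_apply_eq_comp, sub_apply] at h ⊢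
      rw [h, sub_self]
    · simp [hv0 ζ hζ]
  · intro a c h1 h2
    have h3 : star y * a = c * star y := by
      have := congrArg star h2
      simpa using this
    -- `y*y c = y* a y = c y*y`, so `c` commutes with `|y|` by functional calculus and preserves
    -- both its range and its kernel.
    have h4 : Commute (star y * y) c := by
      change star y * y * c = c * (star y * y)
      rw [mul_assoc, ← h1, ← mul_assoc, h3, mul_assoc]
    have h5 : p * c = c * p := by
      have : Commute p c := by
        rw [hp, CFC.abs, CFC.sqrt_eq_nnrpow]
        exact (h4.cfcₙ_nnreal _)
      exact this
    have := hzero (a * v - v * c) (fun ζ => ?_) (fun ζ hζ => ?_)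
    · exact sub_eq_zero.1 this
    · have e1 := congrArg (fun T : K →L[ℂ] K => T ζ) h1
      have e2 := congrArg (fun T : K →L[ℂ] K => T ζ) h5
      simp only [mul_apply_eq_comp, sub_apply] at e1 e2 ⊢
      rw [hvp, ← e2, hvp, e1, sub_self]
    · have e2 := congrArg (fun T : K →L[ℂ] K => T ζ) h5
      simp only [mul_apply_eq_comp, sub_apply] at e2 ⊢
      rw [hv0 ζ hζ, hv0 (c ζ) (by rw [e2, hζ, map_zero]), map_zero, sub_self]

/-- A von Neumann algebra is linearly spanned by its unitaries. -/
theorem eq_sum_unitary_of_mem (Q : VonNeumannAlgebra K) {x : K →L[ℂ] K} (hx : x ∈ Q) :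
    ∃ (u : Fin 4 → K →L[ℂ] K) (c : Fin 4 → ℂ),
      (∀ i, u i ∈ Q ∧ u i ∈ unitary (K →L[ℂ] K)) ∧ x = ∑ i, c i • u i := by
  -- Being a commutant, `Q` is norm closed, hence a C⋆-algebra in its own right; the four unitaries
  -- can then be chosen inside `Q`.
  have hcl : IsClosed (Q.toStarSubalgebra : Set (K →L[ℂ] K)) := by
    have := Q.centralizer_centralizer
    rw [VonNeumannAlgebra.coe_toStarSubalgebra, ← this]
    exact Set.isClosed_centralizer _
  have : IsClosed (Q.toStarSubalgebra : Set (K →L[ℂ] K)) := hcl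
  obtain ⟨u, c, h, -⟩ := CStarAlgebra.exists_sum_four_unitary
    (⟨x, hx⟩ : Q.toStarSubalgebra)
  refine ⟨fun i => ((u i : Q.toStarSubalgebra) : K →L[ℂ] K), c, fun i => ⟨(u i).1.2, ?_⟩, ?_⟩
  · have h1 := (u i).2
    rw [Unitary.mem_iff] at h1 ⊢
    exact ⟨congrArg Subtype.val h1.1, congrArg Subtype.val h1.2⟩
  · have := congrArg Subtype.val h
    simpa using this

end OperatorAlgebra

/-! ### Popa's convexity argument -/

section Intertwiner

variable {K : Type*} [NormedAddCommGroup K] [InnerProductSpace ℂ K]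

/-- Evaluation of operators at a vector, as a real linear map. -/
def realEval (Ω : K) : (K →L[ℂ] K) →ₗ[ℝ] K where
  toFun z := z Ω
  map_add' _ _ := rfl
  map_smul' _ _ := rfl

theorem norm_apply_le_of_mem_convexHull {S : Set (K →L[ℂ] K)}
    (h : ∀ a ∈ S, ∀ η, ‖a η‖ ≤ ‖η‖) {a : K →L[ℂ] K} (ha : a ∈ convexHull ℝ S) (η : K) :
    ‖a η‖ ≤ ‖η‖ := by
  have h1 : convexHull ℝ S ⊆ {a | ‖a η‖ ≤ ‖η‖} := convexHull_min (fun a ha => h a ha η) (by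
    have : {a : K →L[ℂ] K | ‖a η‖ ≤ ‖η‖} = realEval η ⁻¹' (Metric.closedBall 0 ‖η‖) := by
      ext; simp [realEval]
    rw [this]
    exact (convex_closedBall 0 ‖η‖).linear_preimage _)
  exact h1 ha

theorem re_inner_of_mem_convexHull {S : Set (K →L[ℂ] K)} {Ω : K} {c : ℝ}
    (h : ∀ a ∈ S, c ≤ (⟪Ω, a Ω⟫_ℂ).re) {a : K →L[ℂ] K} (ha : a ∈ convexHull ℝ S) :
    c ≤ (⟪Ω, a Ω⟫_ℂ).re := by
  let φ : (K →L[ℂ] K) →ₗ[ℝ] ℝ :=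
    { toFun := fun a => (⟪Ω, a Ω⟫_ℂ).re
      map_add' := fun a a' => by simp
      map_smul' := fun r a => by
        have : (r • a) Ω = (r : ℂ) • a Ω := by simp
        simp only [this, inner_smul_right]
        simp }
  exact convexHull_min (t := {a | c ≤ φ a}) h (convex_halfSpace_ge φ.isLinear c) ha

theorem mul_mul_mem_convexHull {S : Set (K →L[ℂ] K)} {p q : K →L[ℂ] K}
    (h : ∀ a ∈ S, p * a * q ∈ convexHull ℝ S) {a : K →L[ℂ] K} (ha : a ∈ convexHull ℝ S) :
    p * a * q ∈ convexHull ℝ S :=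
  convexHull_min (t := (LinearMap.mulLeftRight ℝ (p, q)) ⁻¹' convexHull ℝ S)
    (fun a ha => h a ha) ((convex_convexHull ℝ S).linear_preimage _) ha

variable [CompleteSpace K]

theorem convexHull_subset_vn (N : VonNeumannAlgebra K) {S : Set (K →L[ℂ] K)}
    (h : ∀ a ∈ S, a ∈ N) {a : K →L[ℂ] K} (ha : a ∈ convexHull ℝ S) : a ∈ N :=
  convexHull_min h (N.toStarSubalgebra.toSubalgebra.toSubmodule.restrictScalars ℝ).convex ha

/-- A nonempty closed convex set contains a point which is determined by its norm, namely the
point of minimal norm. -/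
theorem exists_minimal_norm_of_isClosed_convex {D : Set K} (hne : D.Nonempty) (hcl : IsClosed D)
    (hconv : Convex ℝ D) :
    ∃ ζ ∈ D, ∀ w ∈ D, ‖w‖ = ‖ζ‖ → w = ζ := by
  let _ : InnerProductSpace ℝ K := InnerProductSpace.complexToReal
  obtain ⟨ζ, hζ, hmin⟩ := exists_norm_eq_iInf_of_complete_convex hne hcl.isComplete hconv 0
  have hle : ∀ w ∈ D, ‖ζ‖ ≤ ‖w‖ := fun w hw => by
    have h1 : (⨅ w : D, ‖(0 : K) - w‖) ≤ ‖(0 : K) - w‖ :=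
      ciInf_le ⟨0, Set.forall_mem_range.2 fun _ => norm_nonneg _⟩ (⟨w, hw⟩ : D)
    rw [← hmin] at h1
    simpa using h1
  -- The midpoint of `w` and `ζ` has norm at least `‖ζ‖`, so the parallelogram law leaves no room
  -- for `w - ζ`.
  refine ⟨ζ, hζ, fun w hw hwζ => ?_⟩
  have h1 : ‖ζ‖ ≤ ‖(1 / 2 : ℝ) • w + (1 / 2 : ℝ) • ζ‖ :=
    hle _ (hconv hw hζ (by norm_num) (by norm_num) (by norm_num))
  rw [← smul_add, norm_smul] at h1
  have h2 := parallelogram_law_with_norm ℝ w ζ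
  have h3 : 2 * ‖ζ‖ ≤ ‖w + ζ‖ := by
    norm_num at h1
    linarith
  have h4 : ‖w - ζ‖ = 0 := by
    nlinarith [norm_nonneg (w - ζ), norm_nonneg ζ, norm_nonneg (w + ζ)]
  exact sub_eq_zero.1 (norm_eq_zero.1 h4)

/-- If `Ω` is separating for `N`, vectors which are bounded with respect to the commutant of `N`
come from elements of `N`. -/
theorem exists_mem_apply_eq_of_commutant_bounded (N : VonNeumannAlgebra K) (Ω ζ : K)
    (hsep : Dense {η | ∃ z ∈ N.commutant, z Ω = η})
    (hζ : ∀ z ∈ N.commutant, ‖z ζ‖ ≤ ‖z Ω‖) : ∃ y ∈ N, y Ω = ζ := by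
  let ev (η : K) : N.commutant.toStarSubalgebra →ₗ[ℂ] K :=
    { toFun := fun z => (z : K →L[ℂ] K) η
      map_add' := fun _ _ => rfl
      map_smul' := fun _ _ => rfl }
  have hde : DenseRange (ev Ω) := by
    refine hsep.mono ?_
    rintro _ ⟨z, hz, rfl⟩
    exact ⟨⟨z, hz⟩, rfl⟩
  -- `y` extends `zΩ ↦ zζ` for `z` in the commutant; it commutes with the commutant because left
  -- multiplication there acts the same way on both sides.
  let y : K →L[ℂ] K := (ev ζ).extendOfNorm (ev Ω)
  have hy : ∀ z : N.commutant.toStarSubalgebra, y (ev Ω z) = ev ζ z :=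
    LinearMap.extendOfNorm_eq hde ⟨1, fun z => by rw [one_mul]; exact hζ _ z.2⟩
  refine ⟨y, ?_, hy 1⟩
  rw [← VonNeumannAlgebra.commutant_commutant N, VonNeumannAlgebra.mem_commutant_iff]
  intro z hz
  ext η
  refine hde.induction_on (p := fun η => (z * y) η = (y * z) η) η
    (isClosed_eq (by fun_prop) (by fun_prop)) fun z' => ?_
  change z (y (ev Ω z')) = y (z (ev Ω z'))
  rw [hy]
  exact (hy (⟨z, hz⟩ * z')).symm

/-- From `yΩ = 0` follows `y(zΩ) = z(yΩ) = 0` for every `z` in the commutant, and these vectors `zΩ`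
are dense. -/
theorem eq_zero_of_apply_eq_zero (N : VonNeumannAlgebra K) (Ω : K)
    (hsep : Dense {η | ∃ z ∈ N.commutant, z Ω = η}) {y : K →L[ℂ] K} (hy : y ∈ N)
    (h : y Ω = 0) : y = 0 := by
  ext η
  refine hsep.induction (P := fun η => y η = 0) ?_ (isClosed_eq (by fun_prop) (by fun_prop)) η
  rintro _ ⟨z, hz, rfl⟩
  have h1 := congrArg (fun T : K →L[ℂ] K => T Ω) (VonNeumannAlgebra.mem_commutant_iff.1 hz y hy)
  simp only [mul_apply_eq_comp] at h1
  rw [h1, h, map_zero]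

set_option synthInstance.maxHeartbeats 100000 in
/-- Popa's criterion in a von Neumann algebra with a tracial separating vector: uniform closeness
of a homomorphism to the identity on the unitaries of `Q` yields an intertwiner. -/
theorem exists_intertwiner_of_inner_ge (N Q : VonNeumannAlgebra K) (hQN : Q ≤ N) (Ω : K)
    (hsep : Dense {η | ∃ z ∈ N.commutant, z Ω = η})
    (htr : ∀ a ∈ N, ‖star a Ω‖ = ‖a Ω‖)
    (α : (K →L[ℂ] K) ≃⋆ₐ[ℂ] (K →L[ℂ] K)) (hα : ∀ x ∈ Q, α x ∈ N) (c : ℝ) (hc : 0 < c)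
    (h : ∀ x ∈ Q, x ∈ unitary (K →L[ℂ] K) → c ≤ (⟪Ω, (α x * star x) Ω⟫_ℂ).re) :
    ∃ y ∈ N, y ≠ 0 ∧ ∀ x ∈ Q, α x * y = y * x := by
  let S : Set (K →L[ℂ] K) := {a | ∃ x ∈ Q, x ∈ unitary (K →L[ℂ] K) ∧ a = α x * star x}
  let C : Set (K →L[ℂ] K) := convexHull ℝ S
  have hαu : ∀ x ∈ unitary (K →L[ℂ] K), α x ∈ unitary (K →L[ℂ] K) := by
    intro x hx
    rw [Unitary.mem_iff] at hx ⊢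
    rw [← map_star α, ← map_mul, ← map_mul, hx.1, hx.2, map_one]
    exact ⟨rfl, rfl⟩
  have hunorm : ∀ x ∈ unitary (K →L[ℂ] K), ∀ η, ‖x η‖ = ‖η‖ := by
    intro x hx η
    exact ContinuousLinearMap.norm_map_of_mem_unitary hx η
  have hCN : ∀ a ∈ C, a ∈ N := fun a => convexHull_subset_vn N (by
    rintro _ ⟨x, hx, -, rfl⟩
    exact mul_mem (hα x hx) (star_mem (hQN hx)))
  have hC1 : ∀ a ∈ C, ∀ η, ‖a η‖ ≤ ‖η‖ := fun a => norm_apply_le_of_mem_convexHull (by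
    rintro _ ⟨x, hx, hxu, rfl⟩ η
    rw [mul_apply_eq_comp, hunorm _ (hαu x hxu), hunorm _ (Unitary.star_mem hxu)])
  have hCc : ∀ a ∈ C, c ≤ (⟪Ω, a Ω⟫_ℂ).re := fun a => re_inner_of_mem_convexHull (by
    rintro _ ⟨x, hx, hxu, rfl⟩
    exact h x hx hxu)
  -- `α(x) (α(x') x'*) x* = α(xx') (xx')*`, so the generating set itself is preserved.
  have hCΦ : ∀ x ∈ Q, x ∈ unitary (K →L[ℂ] K) → ∀ a ∈ C, α x * a * star x ∈ C :=
    fun x hx hxu a => mul_mul_mem_convexHull (by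
      rintro _ ⟨x', hx', hxu', rfl⟩
      refine subset_convexHull ℝ S ⟨x * x', mul_mem hx hx', mul_mem hxu hxu', ?_⟩
      rw [map_mul, star_mul]
      simp only [mul_assoc])
  let D : Set K := closure (realEval Ω '' C)
  have hDne : D.Nonempty := by
    refine (Set.Nonempty.image _ ⟨α 1 * star 1, subset_convexHull ℝ S
      ⟨1, one_mem Q, one_mem _, rfl⟩⟩).closure
  obtain ⟨ζ, hζD, huniq⟩ := exists_minimal_norm_of_isClosed_convex hDne isClosed_closure
    (((convex_convexHull ℝ S).linear_image (realEval Ω)).closure)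
  have hD : ∀ P : K → Prop, IsClosed {η | P η} → (∀ a ∈ C, P (a Ω)) → ∀ η ∈ D, P η := by
    intro P hP hCP η hη
    refine closure_minimal (s := realEval Ω '' C) (t := {η | P η}) ?_ hP hη
    rintro _ ⟨a, ha, rfl⟩
    exact hCP a ha
  have hζc : c ≤ (⟪Ω, ζ⟫_ℂ).re := hD (fun η => c ≤ (⟪Ω, η⟫_ℂ).re)
    (isClosed_le continuous_const (Complex.continuous_re.comp (by fun_prop))) hCc ζ hζD
  have hcommC : ∀ z ∈ N.commutant, ∀ a ∈ N, z (a Ω) = a (z Ω) := fun z hz a ha =>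
    (congrArg (fun T : K →L[ℂ] K => T Ω) (VonNeumannAlgebra.mem_commutant_iff.1 hz a ha)).symm
  obtain ⟨y, hyN, hyζ⟩ := exists_mem_apply_eq_of_commutant_bounded N Ω ζ hsep (fun z hz =>
    hD (fun η => ‖z η‖ ≤ ‖z Ω‖) (isClosed_le (by fun_prop) (by fun_prop)) (fun a ha => by
      rw [hcommC z hz a (hCN a ha)]
      exact hC1 a ha _) ζ hζD)
  -- Traciality makes right multiplication by `x*` isometric: `‖a x* Ω‖ = ‖x a* Ω‖ = ‖a* Ω‖ = ‖aΩ‖`.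
  have htr' : ∀ a ∈ N, ∀ x ∈ Q, x ∈ unitary (K →L[ℂ] K) → ‖(α x * a * star x) Ω‖ = ‖a Ω‖ := by
    intro a ha x hx hxu
    have h1 := htr (a * star x) (mul_mem ha (star_mem (hQN hx)))
    rw [mul_assoc, mul_apply_eq_comp, hunorm _ (hαu x hxu), ← h1, star_mul, star_star,
      mul_apply_eq_comp, hunorm _ hxu, htr a ha]
  have hinv : ∀ x ∈ Q, x ∈ unitary (K →L[ℂ] K) → α x * y * star x = y := by
    intro x hx hxu
    have hN1 : α x * y * star x ∈ N := mul_mem (mul_mem (hα x hx) hyN) (star_mem (hQN hx))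
    -- `ζ` is only a limit of vectors `aΩ` with `a ∈ C`; applying the isometry to `y - a` transports
    -- the approximation.
    have hin : (α x * y * star x) Ω ∈ D := by
      rw [Metric.mem_closure_iff]
      intro ε hε
      obtain ⟨_, ⟨a, ha, rfl⟩, hd⟩ := Metric.mem_closure_iff.1 hζD ε hε
      refine ⟨_, ⟨_, hCΦ x hx hxu a ha, rfl⟩, ?_⟩
      rw [dist_eq_norm] at hd ⊢
      have h1 := htr' (y - a) (sub_mem hyN (hCN a ha)) x hx hxu
      rw [mul_sub, sub_mul, sub_apply, sub_apply, hyζ] at h1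
      exact h1.trans_lt hd
    have h2 := huniq _ hin (by rw [htr' y hyN x hx hxu, hyζ])
    refine sub_eq_zero.1 (eq_zero_of_apply_eq_zero N Ω hsep (sub_mem hN1 hyN) ?_)
    rw [sub_apply, h2, hyζ, sub_self]
  refine ⟨y, hyN, ?_, ?_⟩
  · rintro rfl
    rw [← hyζ] at hζc
    simp at hζc
    linarith
  · intro x hx
    obtain ⟨u, k, hu, rfl⟩ := eq_sum_unitary_of_mem Q hx
    rw [map_sum, Finset.sum_mul, Finset.mul_sum]
    refine Finset.sum_congr rfl fun i _ => ?_
    rw [map_smul, smul_mul_assoc, mul_smul_comm]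
    congr 1
    have h1 := congrArg (· * u i) (hinv (u i) (hu i).1 (hu i).2)
    simp only [mul_assoc] at h1
    rwa [(Unitary.mem_iff.1 (hu i).2).1, mul_one] at h1

-- Polar decomposition of the intertwiner `y`. The transfer property of its partial isometry is used
-- twice: with `α(x)` and `x` for the intertwining relation, and with the same element of the
-- commutant of `N` on both sides for membership in `N`.
set_option synthInstance.maxHeartbeats 100000 in
theorem exists_partialIsometry_intertwiner_of_inner_ge (N Q : VonNeumannAlgebra K) (hQN : Q ≤ N)
    (Ω : K) (hsep : Dense {η | ∃ z ∈ N.commutant, z Ω = η})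
    (htr : ∀ a ∈ N, ‖star a Ω‖ = ‖a Ω‖)
    (α : (K →L[ℂ] K) ≃⋆ₐ[ℂ] (K →L[ℂ] K)) (hα : ∀ x ∈ Q, α x ∈ N) (c : ℝ) (hc : 0 < c)
    (h : ∀ x ∈ Q, x ∈ unitary (K →L[ℂ] K) → c ≤ (⟪Ω, (α x * star x) Ω⟫_ℂ).re) :
    ∃ v ∈ N, v ≠ 0 ∧ v * star v * v = v ∧ ∀ x ∈ Q, α x * v = v * x := by
  obtain ⟨y, hyN, hy0, hy⟩ := exists_intertwiner_of_inner_ge N Q hQN Ω hsep htr α hα c hc h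
  obtain ⟨v, hv, hvy, hvi⟩ := exists_polar_partialIsometry y
  refine ⟨v, ?_, ?_, hv, fun x hx => hvi _ _ (hy x hx) ?_⟩
  · rw [← VonNeumannAlgebra.commutant_commutant N, VonNeumannAlgebra.mem_commutant_iff]
    intro z hz
    exact hvi z z (VonNeumannAlgebra.mem_commutant_iff.1 hz y hyN).symm
      (VonNeumannAlgebra.mem_commutant_iff.1 (star_mem hz) y hyN).symm
  · rintro rfl
    exact hy0 (by rw [← hvy, zero_mul])
  · rw [← map_star]
    exact hy _ (star_mem hx)

end Intertwiner

/-! ### Gaussian laws and the Gaussian action on points -/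

section GaussianField

variable {ι H : Type*} [NormedAddCommGroup H] [InnerProductSpace ℝ H]

theorem gaussianField_sum_ae {κ : Type*} (e : HilbertBasis ι ℝ H) (s : Finset κ) (c : κ → ℝ)
    (f : κ → H) : gaussianField e (∑ k ∈ s, c k • f k) =ᵐ[gaussianProduct ι]
      fun z => ∑ k ∈ s, c k * gaussianField e (f k) z := by
  classical
  induction s using Finset.induction_on with
  | empty =>
    simp only [Finset.sum_empty, map_zero]
    exact Lp.coeFn_zero _ _ _
  | insert k s hk ih =>
    simp only [Finset.sum_insert hk, map_add, map_smul]
    filter_upwards [ih, Lp.coeFn_add (c k • gaussianField e (f k))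
      (gaussianField e (∑ k ∈ s, c k • f k)), Lp.coeFn_smul (c k) (gaussianField e (f k))]
      with z h1 h2 h3
    rw [h2, Pi.add_apply, h1, h3, Pi.smul_apply, smul_eq_mul]

theorem gaussianField_basis_ae (e : HilbertBasis ι ℝ H) (i : ι) :
    gaussianField e (e i) =ᵐ[gaussianProduct ι] fun z => z i := by
  rw [gaussianField_basis]
  exact (memLp_coordinate i).coeFn_toLp

theorem integral_norm_le_norm_Lp_two {Ω : Type*} [MeasurableSpace Ω] {P : Measure Ω}
    [IsProbabilityMeasure P] (f : Lp ℝ 2 P) : ∫ z, ‖f z‖ ∂P ≤ ‖f‖ := by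
  rw [integral_norm_eq_lintegral_enorm (Lp.aestronglyMeasurable f), Lp.norm_def,
    ← eLpNorm_one_eq_lintegral_enorm]
  exact ENNReal.toReal_mono (Lp.eLpNorm_ne_top f)
    (eLpNorm_le_eLpNorm_of_exponent_le (by norm_num) (Lp.aestronglyMeasurable f))

theorem integrable_exp_gaussianField (e : HilbertBasis ι ℝ H) (ξ : H) :
    Integrable (fun z => Complex.exp ((gaussianField e ξ z : ℂ) * Complex.I))
      (gaussianProduct ι) := by
  refine Integrable.of_bound ?_ 1 (.of_forall fun z => (Complex.norm_exp_ofReal_mul_I _).le)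
  exact Complex.continuous_exp.comp_aestronglyMeasurable
    ((Complex.continuous_ofReal.comp_aestronglyMeasurable
      (Lp.aestronglyMeasurable _)).mul_const Complex.I)

/-- `|exp(ia) - exp(id)| ≤ |a - d|` and the `L¹` norm is at most the `L²` norm, so the map is even
1-Lipschitz. This allows the characteristic function to be computed on finite combinations of the
basis only. -/
theorem continuous_integral_exp_gaussianField (e : HilbertBasis ι ℝ H) :
    Continuous fun ξ : H =>
      ∫ z, Complex.exp ((gaussianField e ξ z : ℂ) * Complex.I) ∂gaussianProduct ι := by
  refine LipschitzWith.continuous (K := 1) (LipschitzWith.of_dist_le_mul fun ξ η => ?_)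
  rw [dist_eq_norm, dist_eq_norm, NNReal.coe_one, one_mul,
    ← integral_sub (integrable_exp_gaussianField e ξ) (integrable_exp_gaussianField e η)]
  calc _ ≤ ∫ z, ‖gaussianField e (ξ - η) z‖ ∂gaussianProduct ι := by
        refine norm_integral_le_of_norm_le
          ((Lp.memLp (gaussianField e (ξ - η))).integrable (by norm_num)).norm ?_
        rw [map_sub]
        filter_upwards [Lp.coeFn_sub (gaussianField e ξ) (gaussianField e η)] with z hz
        rw [hz, Pi.sub_apply]
        set a := gaussianField e ξ z
        set d := gaussianField e η z
        have h1 : Complex.exp ((a : ℂ) * Complex.I) - Complex.exp ((d : ℂ) * Complex.I) =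
            Complex.exp ((d : ℂ) * Complex.I) *
              (Complex.exp (Complex.I * ((a - d : ℝ) : ℂ)) - 1) := by
          rw [mul_sub, ← Complex.exp_add, mul_one]
          congr 2
          push_cast
          ring
        rw [h1, norm_mul, Complex.norm_exp_ofReal_mul_I, one_mul]
        exact Real.norm_exp_I_mul_ofReal_sub_one_le
    _ ≤ ‖gaussianField e (ξ - η)‖ := integral_norm_le_norm_Lp_two _
    _ = ‖ξ - η‖ := LinearIsometry.norm_map _ _

/-- The random variable attached to `ξ` has the characteristic function of a centred Gaussian
variable of variance `‖ξ‖²`. -/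
theorem integral_exp_gaussianField (e : HilbertBasis ι ℝ H) (ξ : H) :
    ∫ z, Complex.exp ((gaussianField e ξ z : ℂ) * Complex.I) ∂gaussianProduct ι =
      Complex.exp ((-(‖ξ‖ ^ 2 / 2) : ℝ) : ℂ) := by
  have hd : Dense (Submodule.span ℝ (Set.range e) : Set H) := by
    rw [Submodule.dense_iff_topologicalClosure_eq_top]
    exact e.dense_span
  refine hd.induction (P := fun ξ => ∫ z, Complex.exp ((gaussianField e ξ z : ℂ) * Complex.I)
    ∂gaussianProduct ι = Complex.exp ((-(‖ξ‖ ^ 2 / 2) : ℝ) : ℂ)) ?_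
    (isClosed_eq (continuous_integral_exp_gaussianField e) (by fun_prop)) ξ
  intro ξ hξ
  obtain ⟨c, rfl⟩ := Finsupp.mem_span_range_iff_exists_finsupp.1 hξ
  rw [Finsupp.sum]
  have h1 : ∫ z, Complex.exp ((gaussianField e (∑ i ∈ c.support, c i • e i) z : ℂ) * Complex.I)
      ∂gaussianProduct ι =
      ∫ z, ∏ i : c.support, Complex.exp (((c i : ℝ) : ℂ) * (c.support.restrict z i : ℂ) * Complex.I)
        ∂gaussianProduct ι := by
    refine integral_congr_ae ?_
    have h2 : ∀ᵐ z ∂gaussianProduct ι, ∀ i ∈ c.support, gaussianField e (e i) z = z i :=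
      (Filter.eventually_all_finset c.support).2 fun i _ => gaussianField_basis_ae e i
    filter_upwards [gaussianField_sum_ae e c.support c e, h2] with z h3 h4
    rw [h3, ← Complex.exp_sum]
    congr 1
    rw [Finset.univ_eq_attach, ← Finset.sum_mul]
    congr 1
    push_cast
    rw [← Finset.sum_attach]
    refine Finset.sum_congr rfl fun i _ => ?_
    rw [h4 i i.2]
    rfl
  -- Only the finitely many coordinates in the support occur, so the integral factors into
  -- one-dimensional Gaussian characteristic functions.
  have h6 := integral_restrict_infinitePi (μ := fun _ : ι => gaussianReal 0 1) (s := c.support)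
    (f := fun y => ∏ i : c.support, Complex.exp (((c i : ℝ) : ℂ) * (y i : ℂ) * Complex.I))
    (Continuous.aestronglyMeasurable (by fun_prop))
  rw [h1, gaussianProduct, h6, integral_fintype_prod_eq_prod
      (fun (i : c.support) (x : ℝ) => Complex.exp (((c i : ℝ) : ℂ) * (x : ℂ) * Complex.I))]
  have h5 : ‖∑ i ∈ c.support, c i • e i‖ ^ 2 = ∑ i ∈ c.support, c i ^ 2 := by
    rw [← real_inner_self_eq_norm_sq, e.orthonormal.inner_sum]
    simp [sq]
  simp_rw [← charFun_apply_real, charFun_gaussianReal]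
  rw [← Complex.exp_sum, h5, Finset.univ_eq_attach,
    Finset.sum_attach c.support (fun i => ((c i : ℝ) : ℂ) * ((0 : ℝ) : ℂ) * Complex.I -
      ((1 : NNReal) : ℂ) * ((c i : ℝ) : ℂ) ^ 2 / 2)]
  congr 1
  push_cast
  rw [Finset.sum_div, ← Finset.sum_neg_distrib]
  refine Finset.sum_congr rfl fun i _ => ?_
  simp

/-- The joint characteristic function at `t` is that of the field at `∑ t_k f_k`; orthonormality
turns `‖∑ t_k f_k‖²` into `∑ t_k²`, so it factors. -/
theorem map_gaussianField_eq_pi {κ : Type*} [Fintype κ] (e : HilbertBasis ι ℝ H) {f : κ → H}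
    (hf : Orthonormal ℝ f) :
    (gaussianProduct ι).map (fun z k => gaussianField e (f k) z) =
      Measure.pi fun _ : κ => gaussianReal 0 1 := by
  have hm : Measurable fun (z : ι → ℝ) k => gaussianField e (f k) z :=
    measurable_pi_lambda _ fun k => (Lp.stronglyMeasurable _).measurable
  have := Measure.isProbabilityMeasure_map (μ := gaussianProduct ι) hm.aemeasurable
  refine charFun_eq_pi_iff.1 fun t => ?_
  rw [charFun_apply, integral_map (by fun_prop) (by fun_prop),
    integral_map hm.aemeasurable (by fun_prop)]
  have h1 := integral_exp_gaussianField e (∑ k, t k • f k)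
  rw [← real_inner_self_eq_norm_sq, hf.inner_sum] at h1
  have h2 : ∀ᵐ z ∂gaussianProduct ι,
      ⟪WithLp.toLp 2 (fun k => gaussianField e (f k) z), t⟫_ℝ =
        gaussianField e (∑ k, t k • f k) z := by
    filter_upwards [gaussianField_sum_ae e Finset.univ t f] with z hz
    rw [hz, PiLp.inner_apply]
    simp
  rw [integral_congr_ae (g := fun z => Complex.exp
    ((gaussianField e (∑ k, t k • f k) z : ℂ) * Complex.I)) (by
      filter_upwards [h2] with z hz; rw [hz]), h1]
  simp_rw [charFun_gaussianReal]
  rw [← Complex.exp_sum]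
  congr 1
  push_cast
  rw [Finset.sum_div, ← Finset.sum_neg_distrib]
  refine Finset.sum_congr rfl fun i _ => ?_
  simp [sq]

/-- A point realisation of the Gaussian functor applied to an isometry `T`. -/
def gaussianMap (e : HilbertBasis ι ℝ H) (T : H →ₗᵢ[ℝ] H) (z : ι → ℝ) (i : ι) : ℝ :=
  gaussianField e (T (e i)) z

/-- An isometry sends the basis to an orthonormal family, so all finite-dimensional marginals are
standard Gaussian, and these determine the infinite product measure. -/
theorem measurePreserving_gaussianMap (e : HilbertBasis ι ℝ H) (T : H →ₗᵢ[ℝ] H) :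
    MeasurePreserving (gaussianMap e T) (gaussianProduct ι) (gaussianProduct ι) := by
  have hm : Measurable (gaussianMap e T) :=
    measurable_pi_lambda _ fun k => (Lp.stronglyMeasurable _).measurable
  refine ⟨hm, Measure.eq_infinitePi _ fun s t ht => ?_⟩
  have hs : MeasurableSet (Set.univ.pi fun i : s => t i) := .univ_pi fun i => ht i
  have h1 := map_gaussianField_eq_pi e (f := fun i : s => T (e i))
    ((e.orthonormal.comp_linearIsometry T).comp _ Subtype.val_injective)
  have h2 := congrArg (fun m : Measure (s → ℝ) => m (Set.univ.pi fun i : s => t i)) h1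
  simp only [Measure.pi_pi] at h2
  rw [Measure.map_apply (measurable_pi_lambda _ fun k =>
    (Lp.stronglyMeasurable _).measurable) hs] at h2
  rw [Measure.map_apply hm (.pi s.countable_toSet fun i _ => ht i), ← Finset.prod_attach,
    ← Finset.univ_eq_attach, ← h2]
  congr 1
  ext z
  simp [gaussianMap]

/-- Both sides are continuous and linear in `ξ` and agree on the basis by the definition of
`gaussianMap`. -/
theorem gaussianField_comp_gaussianMap (e : HilbertBasis ι ℝ H) (T : H →ₗᵢ[ℝ] H) (ξ : H) :
    (fun z => gaussianField e ξ (gaussianMap e T z)) =ᵐ[gaussianProduct ι]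
      gaussianField e (T ξ) := by
  have hmp := measurePreserving_gaussianMap e T
  let A : H →L[ℝ] Lp ℝ 2 (gaussianProduct ι) := ((Lp.compMeasurePreservingₗᵢ ℝ
    (gaussianMap e T) hmp).comp (gaussianField e)).toContinuousLinearMap
  let B : H →L[ℝ] Lp ℝ 2 (gaussianProduct ι) := ((gaussianField e).comp T).toContinuousLinearMap
  have hd : Dense (Submodule.span ℝ (Set.range e) : Set H) := by
    rw [Submodule.dense_iff_topologicalClosure_eq_top]
    exact e.dense_span
  have hAB : A = B := by
    refine ContinuousLinearMap.ext_on hd ?_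
    rintro _ ⟨i, rfl⟩
    refine Lp.ext ?_
    change Lp.compMeasurePreserving _ hmp (gaussianField e (e i)) =ᵐ[gaussianProduct ι]
      gaussianField e (T (e i))
    filter_upwards [Lp.coeFn_compMeasurePreserving (gaussianField e (e i)) hmp,
      hmp.quasiMeasurePreserving.ae (gaussianField_basis_ae e i)] with z h1 h2
    rw [h1, Function.comp_apply, h2]
    rfl
  have h1 : Lp.compMeasurePreserving _ hmp (gaussianField e ξ) = gaussianField e (T ξ) :=
    congrArg (fun L : H →L[ℝ] Lp ℝ 2 (gaussianProduct ι) => L ξ) hAB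
  rw [← h1]
  exact (Lp.coeFn_compMeasurePreserving (gaussianField e ξ) hmp).symm

theorem omega_comp_gaussianMap (e : HilbertBasis ι ℝ H) (T : H →ₗᵢ[ℝ] H) (ξ : H) :
    (fun z => omega e ξ (gaussianMap e T z)) =ᵐ[gaussianProduct ι] omega e (T ξ) := by
  filter_upwards [coeFn_omega e (T ξ), gaussianField_comp_gaussianMap e T ξ,
    (measurePreserving_gaussianMap e T).quasiMeasurePreserving.ae (coeFn_omega e ξ)] with z h1 h2 h3
  rw [h1, h3, omegaFun, omegaFun, ← h2]

/-- The damping factor of the deformation: the `√2` in `ω` turns the Gaussian exponent `‖ξ‖²/2` into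
`‖ξ‖²`. -/
theorem integral_omega (e : HilbertBasis ι ℝ H) (ξ : H) :
    ∫ z, omega e ξ z ∂gaussianProduct ι = (Real.exp (-‖ξ‖ ^ 2) : ℂ) := by
  have h1 := integral_exp_gaussianField e (√2 • ξ)
  rw [integral_congr_ae (coeFn_omega e ξ)]
  rw [norm_smul, mul_pow, Real.norm_of_nonneg (Real.sqrt_nonneg 2), Real.sq_sqrt (by norm_num)] at h1
  rw [Complex.ofReal_exp]
  convert h1 using 1
  · refine integral_congr_ae ?_
    rw [map_smul]
    filter_upwards [Lp.coeFn_smul √2 (gaussianField e ξ)] with z hz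
    rw [hz, omegaFun]
    rfl
  · congr 2
    ring

end GaussianField

/-! ### Testing `L²` functions against indicators -/

section IndicatorMultiplication

variable {Y : Type*} [MeasurableSpace Y] {m : Measure Y} [IsFiniteMeasure m]

/-- The indicator function of a measurable set as an element of `L^∞`. -/
def indicatorTop (m : Measure Y) [IsFiniteMeasure m] {s : Set Y} (hs : MeasurableSet s) :
    Lp ℂ ∞ m :=
  indicatorConstLp ∞ hs (measure_ne_top m s) 1

theorem mulOp_indicatorTop_const {s : Set Y} (hs : MeasurableSet s) :
    mulOp (indicatorTop m hs) (Lp.const 2 m 1) =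
      indicatorConstLp 2 hs (measure_ne_top m s) 1 := by
  refine Lp.ext ?_
  filter_upwards [coeFn_mulOp (indicatorTop m hs) (Lp.const 2 m 1), Lp.coeFn_const 2 m (1 : ℂ),
    indicatorConstLp_coeFn (p := ∞) (hs := hs) (hμs := measure_ne_top m s) (c := (1 : ℂ)),
    indicatorConstLp_coeFn (p := 2) (hs := hs) (hμs := measure_ne_top m s) (c := (1 : ℂ))]
    with y h1 h2 h3 h4
  rw [h1, h2, h4, indicatorTop, h3]
  simp

theorem inner_mulOp_indicatorTop {s : Set Y} (hs : MeasurableSet s) (f g : Lp ℂ 2 m) :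
    ⟪mulOp (indicatorTop m hs) f, g⟫_ℂ = ⟪f, mulOp (indicatorTop m hs) g⟫_ℂ := by
  refine inner_mulOp_of_ae ?_ f g
  filter_upwards [indicatorConstLp_coeFn (p := ∞) (hs := hs) (hμs := measure_ne_top m s)
    (c := (1 : ℂ))] with y h
  rw [indicatorTop, h]
  by_cases hy : y ∈ s <;> simp [hy]

theorem inner_mulOp_indicatorTop_const {s : Set Y} (hs : MeasurableSet s) (f : Lp ℂ 2 m) :
    ⟪mulOp (indicatorTop m hs) (Lp.const 2 m 1), f⟫_ℂ = ∫ y in s, f y ∂m := by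
  rw [mulOp_indicatorTop_const]
  exact L2.inner_indicatorConstLp_one hs _ f

theorem eq_of_forall_setIntegral_eq {f g : Lp ℂ 2 m}
    (h : ∀ s : Set Y, MeasurableSet s → ∫ y in s, f y ∂m = ∫ y in s, g y ∂m) : f = g := by
  refine Lp.ext ?_
  exact Integrable.ae_eq_of_forall_setIntegral_eq _ _
    ((Lp.memLp f).integrable (by norm_num)) ((Lp.memLp g).integrable (by norm_num))
    fun s hs _ => h s hs

/-- Equality of all set integrals forces `f` to be the complex conjugate of `g` almost everywhere.
-/
theorem norm_eq_of_forall_setIntegral_eq_conj {f g : Lp ℂ 2 m}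
    (h : ∀ s : Set Y, MeasurableSet s →
      ∫ y in s, f y ∂m = starRingEnd ℂ (∫ y in s, g y ∂m)) : ‖f‖ = ‖g‖ := by
  have hg : Integrable g m := (Lp.memLp g).integrable (by norm_num)
  have h1 : f =ᵐ[m] fun y => starRingEnd ℂ (g y) :=
    Integrable.ae_eq_of_forall_setIntegral_eq _ _
      ((Lp.memLp f).integrable (by norm_num)) (Complex.conjCLE.toContinuousLinearMap.integrable_comp hg)
      fun s hs _ => by rw [h s hs, integral_conj]
  refine le_antisymm (Lp.norm_le_norm_of_ae_le ?_) (Lp.norm_le_norm_of_ae_le ?_) <;>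
  · filter_upwards [h1] with y hy
    rw [hy, RCLike.norm_conj]

end IndicatorMultiplication

/-! ### The commutant of the crossed product and its trace vector -/

section Commutant

variable {Γ ι H X : Type*} [NormedAddCommGroup H] [InnerProductSpace ℝ H] [MeasurableSpace X]
variable (μ : Measure X)

theorem star_diagOp {φ ψ : Γ → Lp ℂ ∞ ((gaussianProduct ι).prod μ)} {C D : ℝ} (hC : 0 ≤ C)
    (hφ : ∀ g, ‖φ g‖ ≤ C) (hD : 0 ≤ D) (hψ : ∀ g, ‖ψ g‖ ≤ D)
    (h : ∀ g, ψ g =ᵐ[(gaussianProduct ι).prod μ] fun y => starRingEnd ℂ (φ g y)) :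
    star (diagOp μ φ hC hφ) = diagOp μ ψ hD hψ := by
  rw [ContinuousLinearMap.star_eq_adjoint, eq_comm, ContinuousLinearMap.eq_adjoint_iff]
  intro f f'
  rw [lp.inner_eq_tsum, lp.inner_eq_tsum]
  congr 1
  ext g
  refine inner_mulOp_of_ae ?_ _ _
  filter_upwards [h g] with y hy
  rw [hy, Complex.conj_conj]

theorem diagOp_mul_comm {φ ψ : Γ → Lp ℂ ∞ ((gaussianProduct ι).prod μ)} {C D : ℝ} (hC : 0 ≤ C)
    (hφ : ∀ g, ‖φ g‖ ≤ C) (hD : 0 ≤ D) (hψ : ∀ g, ‖ψ g‖ ≤ D) :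
    diagOp μ φ hC hφ * diagOp μ ψ hD hψ = diagOp μ ψ hD hψ * diagOp μ φ hC hφ := by
  ext1 f
  exact lp.ext (funext fun g => mulOp_comm _ _ _)

/-- Right multiplication by `φ ∈ L^∞(Z × X)`. -/
def rightMul (Γ : Type*) (φ : Lp ℂ ∞ ((gaussianProduct ι).prod μ)) : Op Γ ι μ :=
  diagOp μ (fun _ => φ) (norm_nonneg φ) fun _ => le_rfl

theorem rightMul_apply (φ : Lp ℂ ∞ ((gaussianProduct ι).prod μ)) (f : Space Γ ι μ) (g : Γ) :
    rightMul μ Γ φ f g = mulOp φ (f g) := rfl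

open Classical in
theorem rightMul_single (φ : Lp ℂ ∞ ((gaussianProduct ι).prod μ)) (h : Γ)
    (f : Lp ℂ 2 ((gaussianProduct ι).prod μ)) :
    rightMul μ Γ φ (lp.single 2 h f) = lp.single 2 h (mulOp φ f) := by
  refine lp.ext (funext fun g => ?_)
  rw [rightMul_apply]
  by_cases hg : g = h
  · subst hg
    rw [lp.single_apply_self, lp.single_apply_self]
  · rw [lp.single_apply_ne _ _ _ hg, lp.single_apply_ne _ _ _ hg, map_zero]

variable [Group Γ]

theorem star_groupUnitary (h : Γ) :
    star (groupUnitary μ ι h) = groupUnitary μ ι h⁻¹ := by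
  rw [ContinuousLinearMap.star_eq_adjoint, eq_comm, ContinuousLinearMap.eq_adjoint_iff]
  intro f f'
  rw [lp.inner_eq_tsum, lp.inner_eq_tsum]
  simp only [groupUnitary_apply, inv_inv]
  rw [← (Equiv.mulLeft h).tsum_eq (fun g => ⟪f g, f' (h⁻¹ * g)⟫_ℂ)]
  simp

theorem memlp_rightShift (h : Γ) (f : Space Γ ι μ) :
    Memℓp (fun g => f (g * h⁻¹)) 2 := by
  have hf := (lp.memℓp f).summable (by norm_num)
  refine memℓp_gen ?_
  exact hf.comp_injective (mul_left_injective h⁻¹)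

section Translate

variable [MulAction Γ X] [MeasurableConstSMul Γ X] [SMulInvariantMeasure Γ X μ]

theorem translate_ae (g : Γ) (a : Lp ℂ ∞ μ) :
    translate μ g a =ᵐ[μ] fun x => a (g⁻¹ • x) :=
  Lp.coeFn_compMeasurePreserving _ _

end Translate

variable [IsProbabilityMeasure μ]

theorem oneTensor_ae (a : Lp ℂ ∞ μ) :
    oneTensor μ ι a =ᵐ[(gaussianProduct ι).prod μ] fun y => a y.2 :=
  Lp.coeFn_compMeasurePreserving _ _

theorem traceVector_one : traceVector Γ ι μ 1 = Lp.const 2 _ (1 : ℂ) := by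
  classical
  exact lp.single_apply_self _ _ _

theorem traceVector_of_ne {g : Γ} (hg : g ≠ 1) : traceVector Γ ι μ g = 0 := by
  classical
  exact lp.single_apply_ne _ _ _ hg

theorem inner_traceVector (f : Space Γ ι μ) :
    ⟪traceVector Γ ι μ, f⟫_ℂ = ⟪Lp.const 2 _ (1 : ℂ), f 1⟫_ℂ := by
  classical
  exact lp.inner_single_left 1 _ f

theorem star_omegaOp (e : HilbertBasis ι ℝ H) (π : Γ →* (H ≃ₗᵢ[ℝ] H)) (ξ : H) :
    star (omegaOp μ e π ξ) = omegaOp μ e π (-ξ) := by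
  refine star_diagOp μ _ _ _ _ fun g => ?_
  rw [map_neg]
  exact omegaTensorOne_neg μ e _

variable [MulAction Γ X] [MeasurableConstSMul Γ X] [SMulInvariantMeasure Γ X μ]

theorem oneTensor_translate_ae (g : Γ) (a : Lp ℂ ∞ μ) :
    oneTensor μ ι (translate μ g a) =ᵐ[(gaussianProduct ι).prod μ] fun y => a (g⁻¹ • y.2) := by
  filter_upwards [oneTensor_ae (ι := ι) μ (translate μ g a),
    (measurePreserving_snd (μ := gaussianProduct ι) (ν := μ)).quasiMeasurePreserving.ae
      (translate_ae μ g a)] with y h1 h2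
  rw [h1, h2]

theorem star_functionOp (a : Lp ℂ ∞ μ) :
    star (functionOp μ Γ ι a) = functionOp μ Γ ι (star a) := by
  refine star_diagOp μ _ _ _ _ fun g => ?_
  have hmp : MeasurePreserving (fun y : (ι → ℝ) × X => (g⁻¹)⁻¹ • y.2)
      ((gaussianProduct ι).prod μ) μ :=
    (measurePreserving_smul (g⁻¹)⁻¹ μ).comp measurePreserving_snd
  filter_upwards [oneTensor_translate_ae (ι := ι) μ g⁻¹ a,
    oneTensor_translate_ae (ι := ι) μ g⁻¹ (star a),
    hmp.quasiMeasurePreserving.ae (Lp.coeFn_star a)] with y h1 h2 h3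
  rw [h1, h2, h3]
  rfl

/-- The generating family is closed under adjoints, so the adjoint half of the commutation condition
is automatic. -/
theorem mem_commutant_smallAlgebra {z : Op Γ ι μ}
    (h1 : ∀ a, functionOp μ Γ ι a * z = z * functionOp μ Γ ι a)
    (h2 : ∀ h, groupUnitary μ ι h * z = z * groupUnitary μ ι h) :
    z ∈ (smallAlgebra μ Γ ι).commutant := by
  rw [smallAlgebra, vnGenerated, VonNeumannAlgebra.commutant_commutant, mem_commutantOf]
  rintro _ (⟨a, rfl⟩ | ⟨h, rfl⟩)
  · exact ⟨h1 a, by rw [star_functionOp, h1]⟩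
  · exact ⟨h2 h, by rw [star_groupUnitary, h2]⟩

theorem mem_commutant_bigAlgebra (e : HilbertBasis ι ℝ H) (π : Γ →* (H ≃ₗᵢ[ℝ] H)) {z : Op Γ ι μ}
    (h0 : ∀ ξ, omegaOp μ e π ξ * z = z * omegaOp μ e π ξ)
    (h1 : ∀ a, functionOp μ Γ ι a * z = z * functionOp μ Γ ι a)
    (h2 : ∀ h, groupUnitary μ ι h * z = z * groupUnitary μ ι h) :
    z ∈ (bigAlgebra μ e π).commutant := by
  have hz : z ∈ (baseAlgebra μ e π).commutant := by
    rw [baseAlgebra, vnGenerated, VonNeumannAlgebra.commutant_commutant, mem_commutantOf]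
    rintro _ (⟨ξ, rfl⟩ | ⟨a, rfl⟩)
    · exact ⟨h0 ξ, by rw [star_omegaOp, h0]⟩
    · exact ⟨h1 a, by rw [star_functionOp, h1]⟩
  rw [VonNeumannAlgebra.mem_commutant_iff] at hz
  rw [bigAlgebra, vnGenerated, VonNeumannAlgebra.commutant_commutant, mem_commutantOf]
  rintro x (hx | ⟨h, rfl⟩)
  · exact ⟨hz x hx, hz _ (star_mem (S := VonNeumannAlgebra (Space Γ ι μ)) hx)⟩
  · exact ⟨h2 h, by rw [star_groupUnitary, h2]⟩

/-- The same function acts on every fibre: left translation does not see it, and diagonal operators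
commute with it because `L^∞` is commutative. -/
theorem rightMul_mem_commutant (e : HilbertBasis ι ℝ H) (π : Γ →* (H ≃ₗᵢ[ℝ] H))
    (φ : Lp ℂ ∞ ((gaussianProduct ι).prod μ)) :
    rightMul μ Γ φ ∈ (bigAlgebra μ e π).commutant := by
  refine mem_commutant_bigAlgebra μ e π (fun ξ => ?_) (fun a => ?_) (fun h => ?_)
  · exact diagOp_mul_comm μ _ _ _ _
  · exact diagOp_mul_comm μ _ _ _ _
  · ext1 f
    refine lp.ext (funext fun g => ?_)
    change mulOp φ (f (h⁻¹ * g)) = mulOp φ (f (h⁻¹ * g))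
    rfl

theorem measurePreserving_koopman (e : HilbertBasis ι ℝ H) (T : H →ₗᵢ[ℝ] H) (h : Γ) :
    MeasurePreserving (Prod.map (gaussianMap e T) fun x : X => h • x)
      ((gaussianProduct ι).prod μ) ((gaussianProduct ι).prod μ) :=
  (measurePreserving_gaussianMap e T).prod (measurePreserving_smul h μ)

/-- The isometry of `L²(Z × X)` induced by the diagonal action of `h⁻¹`. -/
def koopman (e : HilbertBasis ι ℝ H) (π : Γ →* (H ≃ₗᵢ[ℝ] H)) (h : Γ) :
    Lp ℂ 2 ((gaussianProduct ι).prod μ) →ₗᵢ[ℂ] Lp ℂ 2 ((gaussianProduct ι).prod μ) :=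
  Lp.compMeasurePreservingₗᵢ ℂ _ (measurePreserving_koopman μ e (π h⁻¹).toLinearIsometry h)

theorem koopman_ae (e : HilbertBasis ι ℝ H) (π : Γ →* (H ≃ₗᵢ[ℝ] H)) (h : Γ)
    (f : Lp ℂ 2 ((gaussianProduct ι).prod μ)) :
    koopman μ e π h f =ᵐ[(gaussianProduct ι).prod μ]
      fun y => f (Prod.map (gaussianMap e (π h⁻¹).toLinearIsometry) (fun x => h • x) y) :=
  Lp.coeFn_compMeasurePreserving f
    (measurePreserving_koopman μ e (π h⁻¹).toLinearIsometry h)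

theorem koopman_mulOp (e : HilbertBasis ι ℝ H) (π : Γ →* (H ≃ₗᵢ[ℝ] H)) (h : Γ)
    {φ ψ : Lp ℂ ∞ ((gaussianProduct ι).prod μ)}
    (hφψ : ψ =ᵐ[(gaussianProduct ι).prod μ]
      fun y => φ (Prod.map (gaussianMap e (π h⁻¹).toLinearIsometry) (fun x => h • x) y))
    (f : Lp ℂ 2 ((gaussianProduct ι).prod μ)) :
    koopman μ e π h (mulOp φ f) = mulOp ψ (koopman μ e π h f) := by
  refine Lp.ext ?_
  have hq := (measurePreserving_koopman μ e (π h⁻¹).toLinearIsometry h).quasiMeasurePreserving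
  filter_upwards [koopman_ae μ e π h (mulOp φ f), coeFn_mulOp ψ (koopman μ e π h f),
    koopman_ae μ e π h f, hφψ, hq.ae (coeFn_mulOp φ f)] with y h1 h2 h3 h4 h5
  rw [h1, h2, h3, h4, h5]

theorem koopman_const (e : HilbertBasis ι ℝ H) (π : Γ →* (H ≃ₗᵢ[ℝ] H)) (h : Γ) (c : ℂ) :
    koopman μ e π h (Lp.const 2 _ c) = Lp.const 2 _ c := by
  refine Lp.ext ?_
  have hq := (measurePreserving_koopman μ e (π h⁻¹).toLinearIsometry h).quasiMeasurePreserving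
  filter_upwards [koopman_ae μ e π h (Lp.const 2 _ c), hq.ae (Lp.coeFn_const 2 _ c),
    Lp.coeFn_const 2 _ c] with y h1 h2 h3
  rw [h1, h2, h3]
  rfl

/-- Right multiplication by the canonical unitary `u_h`. -/
def rightShift (e : HilbertBasis ι ℝ H) (π : Γ →* (H ≃ₗᵢ[ℝ] H)) (h : Γ) : Op Γ ι μ :=
  (lp.mapCLM 2 (fun _ : Γ => (koopman μ e π h).toContinuousLinearMap) zero_le_one
    fun _ => LinearIsometry.norm_toContinuousLinearMap_le _) ∘L
  LinearMap.mkContinuous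
    { toFun := fun f => (⟨fun g => f (g * h⁻¹), memlp_rightShift μ h f⟩ : Space Γ ι μ)
      map_add' := fun _ _ => by ext1; rfl
      map_smul' := fun _ _ => by ext1; rfl } 1 fun f => by
    rw [one_mul]
    refine le_of_eq ?_
    rw [lp.norm_eq_tsum_rpow (by norm_num), lp.norm_eq_tsum_rpow (by norm_num)]
    congr 1
    exact (Equiv.mulRight h⁻¹).tsum_eq (fun g => ‖f g‖ ^ (2 : ℝ≥0∞).toReal)

theorem rightShift_apply (e : HilbertBasis ι ℝ H) (π : Γ →* (H ≃ₗᵢ[ℝ] H)) (h : Γ)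
    (f : Space Γ ι μ) (g : Γ) :
    rightShift μ e π h f g = koopman μ e π h (f (g * h⁻¹)) := rfl

/-- Right translation replaces the twist by `g⁻¹` with the twist by `(g h⁻¹)⁻¹ = h g⁻¹`; the Koopman
operator acts by `h⁻¹` and undoes the difference. Right translation commutes with left translation.
-/
theorem rightShift_mem_commutant (e : HilbertBasis ι ℝ H) (π : Γ →* (H ≃ₗᵢ[ℝ] H)) (h : Γ) :
    rightShift μ e π h ∈ (bigAlgebra μ e π).commutant := by
  have hq := (measurePreserving_koopman (X := X) μ e (π h⁻¹).toLinearIsometry h).quasiMeasurePreserving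
  refine mem_commutant_bigAlgebra μ e π (fun ξ => ?_) (fun a => ?_) (fun k => ?_)
  · ext1 f
    refine lp.ext (funext fun g => ?_)
    change mulOp _ (koopman μ e π h _) = koopman μ e π h (mulOp _ _)
    refine (koopman_mulOp μ e π h ?_ _).symm
    filter_upwards [coeFn_omegaTensorOne μ e (π g⁻¹ ξ),
      hq.ae (coeFn_omegaTensorOne μ e (π (g * h⁻¹)⁻¹ ξ)),
      (measurePreserving_fst (μ := gaussianProduct ι) (ν := μ)).quasiMeasurePreserving.ae
        (omega_comp_gaussianMap e (π h⁻¹).toLinearIsometry (π (g * h⁻¹)⁻¹ ξ))] with y h1 h2 h3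
    have h4 : (π h⁻¹).toLinearIsometry (π (g * h⁻¹)⁻¹ ξ) = π g⁻¹ ξ := by
      change (π h⁻¹ * π (g * h⁻¹)⁻¹) ξ = _
      rw [← map_mul]
      congr 2
      group
    rw [h4] at h3
    rw [h1, h2, ← h3]
    rfl
  · ext1 f
    refine lp.ext (funext fun g => ?_)
    change mulOp _ (koopman μ e π h _) = koopman μ e π h (mulOp _ _)
    refine (koopman_mulOp μ e π h ?_ _).symm
    filter_upwards [oneTensor_translate_ae (ι := ι) μ g⁻¹ a,
      hq.ae (oneTensor_translate_ae (ι := ι) μ (g * h⁻¹)⁻¹ a)] with y h1 h2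
    rw [h1, h2, Prod.map_snd, smul_smul]
    congr 2
    group
  · ext1 f
    refine lp.ext (funext fun g => ?_)
    change koopman μ e π h (f (k⁻¹ * g * h⁻¹)) = koopman μ e π h (f (k⁻¹ * (g * h⁻¹)))
    rw [mul_assoc]

open Classical in
theorem rightShift_traceVector (e : HilbertBasis ι ℝ H) (π : Γ →* (H ≃ₗᵢ[ℝ] H)) (h : Γ) :
    rightShift μ e π h (traceVector Γ ι μ) = lp.single 2 h (Lp.const 2 _ (1 : ℂ)) := by
  refine lp.ext (funext fun g => ?_)
  rw [rightShift_apply]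
  by_cases hg : g = h
  · subst hg
    rw [mul_inv_cancel, traceVector_one, koopman_const, lp.single_apply_self]
  · rw [traceVector_of_ne, map_zero, lp.single_apply_ne _ _ _ hg]
    rwa [Ne, mul_inv_eq_one]

/-- The trace vector is separating for `M̃`. -/
theorem dense_commutant_traceVector (e : HilbertBasis ι ℝ H) (π : Γ →* (H ≃ₗᵢ[ℝ] H)) :
    Dense {η | ∃ z ∈ (bigAlgebra μ e π).commutant, z (traceVector Γ ι μ) = η} := by
  classical
  let S : Submodule ℂ (Space Γ ι μ) :=
    { carrier := {η | ∃ z ∈ (bigAlgebra μ e π).commutant, z (traceVector Γ ι μ) = η}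
      add_mem' := by
        rintro _ _ ⟨z, hz, rfl⟩ ⟨w, hw, rfl⟩
        exact ⟨z + w, add_mem hz hw, rfl⟩
      zero_mem' := ⟨0, zero_mem _, rfl⟩
      smul_mem' := by
        rintro c _ ⟨z, hz, rfl⟩
        exact ⟨c • z, (bigAlgebra μ e π).commutant.toStarSubalgebra.smul_mem hz c, rfl⟩ }
  change Dense (S : Set (Space Γ ι μ))
  rw [Submodule.dense_iff_topologicalClosure_eq_top, Submodule.topologicalClosure_eq_top_iff,
    Submodule.eq_bot_iff]
  intro f hf
  refine lp.ext (funext fun h => ?_)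
  refine eq_of_forall_setIntegral_eq fun s hs => ?_
  -- The commutant element, right shift followed by right multiplication, sends the trace vector to
  -- the indicator of `s` placed at `h`; orthogonality to all of these kills every set integral of
  -- `f h`.
  have h1 := (Submodule.mem_orthogonal _ _).1 hf _
    ⟨_, mul_mem (rightMul_mem_commutant μ e π (indicatorTop _ hs))
      (rightShift_mem_commutant μ e π h), rfl⟩
  rw [mul_apply_eq_comp, rightShift_traceVector, rightMul_single, lp.inner_single_left,
    inner_mulOp_indicatorTop_const] at h1
  rw [h1, lp.coeFn_zero, Pi.zero_apply, ← inner_mulOp_indicatorTop_const hs, inner_zero_right]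

theorem apply_commutant_apply (e : HilbertBasis ι ℝ H) (π : Γ →* (H ≃ₗᵢ[ℝ] H))
    {a z : Op Γ ι μ} (ha : a ∈ bigAlgebra μ e π) (hz : z ∈ (bigAlgebra μ e π).commutant)
    (η : Space Γ ι μ) : a (z η) = z (a η) :=
  congrArg (fun T : Op Γ ι μ => T η) (VonNeumannAlgebra.mem_commutant_iff.1 hz a ha)

-- Matrix coefficients of `a` and `a*` are conjugate. Localising to `s` is possible because
-- multiplication by its indicator lies in the commutant and can be moved through `a`.
open Classical in
theorem setIntegral_apply_single (e : HilbertBasis ι ℝ H) (π : Γ →* (H ≃ₗᵢ[ℝ] H))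
    {a : Op Γ ι μ} (ha : a ∈ bigAlgebra μ e π) (g : Γ) {s : Set ((ι → ℝ) × X)}
    (hs : MeasurableSet s) :
    ∫ y in s, a (lp.single 2 g (Lp.const 2 _ (1 : ℂ))) 1 y ∂(gaussianProduct ι).prod μ =
      starRingEnd ℂ (∫ y in s, star a (traceVector Γ ι μ) g y ∂(gaussianProduct ι).prod μ) := by
  set φ := indicatorTop ((gaussianProduct ι).prod μ) hs with hφ
  set δ : Space Γ ι μ := lp.single 2 g (Lp.const 2 _ (1 : ℂ)) with hδ
  have h1 : rightMul μ Γ φ (a δ) = a (lp.single 2 g (mulOp φ (Lp.const 2 _ (1 : ℂ)))) := by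
    rw [← apply_commutant_apply μ e π ha (rightMul_mem_commutant μ e π _), hδ, rightMul_single]
  have h2 : ⟪Lp.const 2 _ (1 : ℂ), mulOp φ (a δ 1)⟫_ℂ =
      ⟪traceVector Γ ι μ, rightMul μ Γ φ (a δ)⟫_ℂ := by
    rw [inner_traceVector, rightMul_apply]
  have h3 : ⟪traceVector Γ ι μ, a (lp.single 2 g (mulOp φ (Lp.const 2 _ (1 : ℂ))))⟫_ℂ =
      ⟪star a (traceVector Γ ι μ) g, mulOp φ (Lp.const 2 _ (1 : ℂ))⟫_ℂ := by
    rw [← ContinuousLinearMap.adjoint_inner_left]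
    exact lp.inner_single_right g _ _
  rw [← inner_mulOp_indicatorTop_const hs, ← inner_mulOp_indicatorTop_const hs,
    inner_mulOp_indicatorTop, inner_conj_symm, ← h3, ← h1]
  exact h2

/-- The modular conjugation of `M̃` is fibrewise isometric up to inversion in `Γ`. -/
theorem norm_star_apply_traceVector_apply (e : HilbertBasis ι ℝ H) (π : Γ →* (H ≃ₗᵢ[ℝ] H))
    {a : Op Γ ι μ} (ha : a ∈ bigAlgebra μ e π) (g : Γ) :
    ‖star a (traceVector Γ ι μ) g‖ = ‖a (traceVector Γ ι μ) g⁻¹‖ := by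
  classical
  have h1 : a (lp.single 2 g (Lp.const 2 _ (1 : ℂ))) 1 =
      koopman μ e π g (a (traceVector Γ ι μ) g⁻¹) := by
    rw [← rightShift_traceVector μ e π,
      apply_commutant_apply μ e π ha (rightShift_mem_commutant μ e π g), rightShift_apply, one_mul]
  rw [← LinearIsometry.norm_map (koopman μ e π g) (a (traceVector Γ ι μ) g⁻¹), ← h1, eq_comm]
  exact norm_eq_of_forall_setIntegral_eq_conj fun s hs => setIntegral_apply_single μ e π ha g hs

/-- Traciality of the vector state: the fibrewise norms agree up to `g ↦ g⁻¹`, which only permutes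
the sum of squares. -/
theorem norm_star_apply_traceVector (e : HilbertBasis ι ℝ H) (π : Γ →* (H ≃ₗᵢ[ℝ] H))
    {a : Op Γ ι μ} (ha : a ∈ bigAlgebra μ e π) :
    ‖star a (traceVector Γ ι μ)‖ = ‖a (traceVector Γ ι μ)‖ := by
  rw [lp.norm_eq_tsum_rpow (by norm_num), lp.norm_eq_tsum_rpow (by norm_num)]
  congr 1
  rw [← (Equiv.inv Γ).tsum_eq]
  refine tsum_congr fun g => ?_
  rw [norm_star_apply_traceVector_apply μ e π ha]
  simp

end Commutant

/-! ### Projection onto the functions on `X` -/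

section BaseFactor

variable {Γ ι H X : Type*} [NormedAddCommGroup H] [InnerProductSpace ℝ H] [MeasurableSpace X]
variable (μ : Measure X)

theorem inner_mulOp_star (a : Lp ℂ ∞ μ) (p q : Lp ℂ 2 μ) :
    ⟪mulOp (star a) p, q⟫_ℂ = ⟪p, mulOp a q⟫_ℂ := by
  refine inner_mulOp_of_ae ?_ p q
  filter_upwards [Lp.coeFn_star a] with y hy
  rw [hy]
  exact (Complex.conj_conj _).symm

variable [IsProbabilityMeasure μ]

/-- The embedding `p ↦ 1 ⊗ p` of `L²(X)` into `L²(Z × X)`. -/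
def sndEmbedding (ι : Type*) : Lp ℂ 2 μ →ₗᵢ[ℂ] Lp ℂ 2 ((gaussianProduct ι).prod μ) :=
  Lp.compMeasurePreservingₗᵢ ℂ Prod.snd measurePreserving_snd

theorem sndEmbedding_ae (p : Lp ℂ 2 μ) :
    sndEmbedding μ ι p =ᵐ[(gaussianProduct ι).prod μ] fun y => p y.2 :=
  Lp.coeFn_compMeasurePreserving p measurePreserving_snd

theorem sndEmbedding_mulOp (a : Lp ℂ ∞ μ) (p : Lp ℂ 2 μ) :
    sndEmbedding μ ι (mulOp a p) = mulOp (oneTensor μ ι a) (sndEmbedding μ ι p) := by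
  refine Lp.ext ?_
  filter_upwards [sndEmbedding_ae (ι := ι) μ (mulOp a p), sndEmbedding_ae (ι := ι) μ p,
    coeFn_mulOp (oneTensor μ ι a) (sndEmbedding μ ι p), oneTensor_ae (ι := ι) μ a,
    (measurePreserving_snd (μ := gaussianProduct ι) (ν := μ)).quasiMeasurePreserving.ae
      (coeFn_mulOp a p)] with y h1 h2 h3 h4 h5
  rw [h1, h3, h4, h2, h5]

theorem sndEmbedding_const (c : ℂ) :
    sndEmbedding μ ι (Lp.const 2 μ c) = Lp.const 2 _ c := by
  refine Lp.ext ?_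
  filter_upwards [sndEmbedding_ae (ι := ι) μ (Lp.const 2 μ c), Lp.coeFn_const 2 _ c,
    (measurePreserving_snd (μ := gaussianProduct ι) (ν := μ)).quasiMeasurePreserving.ae
      (Lp.coeFn_const 2 μ c)] with y h1 h2 h3
  rw [h1, h2, h3]
  rfl

/-- The conditional expectation of `L²(Z × X)` onto `L²(X)`. -/
def sndAdjoint (ι : Type*) : Lp ℂ 2 ((gaussianProduct ι).prod μ) →L[ℂ] Lp ℂ 2 μ :=
  ContinuousLinearMap.adjoint (sndEmbedding μ ι).toContinuousLinearMap

theorem inner_sndAdjoint (p : Lp ℂ 2 μ) (f : Lp ℂ 2 ((gaussianProduct ι).prod μ)) :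
    ⟪p, sndAdjoint μ ι f⟫_ℂ = ⟪sndEmbedding μ ι p, f⟫_ℂ :=
  ContinuousLinearMap.adjoint_inner_right _ _ _

theorem sndAdjoint_sndEmbedding (p : Lp ℂ 2 μ) : sndAdjoint μ ι (sndEmbedding μ ι p) = p := by
  refine ext_inner_left ℂ fun q => ?_
  rw [inner_sndAdjoint, LinearIsometry.inner_map_map]

theorem oneTensor_star_ae (a : Lp ℂ ∞ μ) :
    oneTensor μ ι (star a) =ᵐ[(gaussianProduct ι).prod μ]
      fun y => starRingEnd ℂ (oneTensor μ ι a y) := by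
  filter_upwards [oneTensor_ae (ι := ι) μ (star a), oneTensor_ae (ι := ι) μ a,
    (measurePreserving_snd (μ := gaussianProduct ι) (ν := μ)).quasiMeasurePreserving.ae
      (Lp.coeFn_star a)] with y h1 h2 h3
  rw [h1, h2, h3]
  rfl

theorem sndAdjoint_mulOp (a : Lp ℂ ∞ μ) (f : Lp ℂ 2 ((gaussianProduct ι).prod μ)) :
    sndAdjoint μ ι (mulOp (oneTensor μ ι a) f) = mulOp a (sndAdjoint μ ι f) := by
  refine ext_inner_left ℂ fun p => ?_
  rw [inner_sndAdjoint, ← inner_mulOp_star μ a p, inner_sndAdjoint, sndEmbedding_mulOp]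
  refine (inner_mulOp_of_ae ?_ _ _).symm
  filter_upwards [oneTensor_star_ae (ι := ι) μ a] with y hy
  rw [hy, Complex.conj_conj]

/-- The projection of `L²(Z × X)` onto `1 ⊗ L²(X)`. -/
def sndProjection (ι : Type*) :
    Lp ℂ 2 ((gaussianProduct ι).prod μ) →L[ℂ] Lp ℂ 2 ((gaussianProduct ι).prod μ) :=
  (sndEmbedding μ ι).toContinuousLinearMap ∘L sndAdjoint μ ι

theorem norm_sndProjection_le : ‖sndProjection μ ι‖ ≤ 1 := by
  have h1 : ‖(sndEmbedding μ ι).toContinuousLinearMap‖ ≤ 1 :=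
    LinearIsometry.norm_toContinuousLinearMap_le _
  have h2 : ‖sndAdjoint μ ι‖ ≤ 1 := by
    rw [sndAdjoint, LinearIsometryEquiv.norm_map]
    exact h1
  refine (ContinuousLinearMap.opNorm_comp_le _ _).trans ?_
  calc _ ≤ (1 : ℝ) * 1 := by gcongr
    _ = 1 := one_mul 1

/-- The projection of `ℓ²(Γ, L²(Z × X))` onto `ℓ²(Γ, 1 ⊗ L²(X))`. -/
def fibreProjection (Γ ι : Type*) : Op Γ ι μ :=
  lp.mapCLM 2 (fun _ : Γ => sndProjection μ ι) zero_le_one fun _ => norm_sndProjection_le μ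

theorem fibreProjection_apply (f : Space Γ ι μ) (g : Γ) :
    fibreProjection μ Γ ι f g = sndEmbedding μ ι (sndAdjoint μ ι (f g)) := rfl

/-- Fubini separates the Gaussian variable from `X`, so `ω(ξ)` contributes only its integral. -/
theorem inner_sndEmbedding_omega (e : HilbertBasis ι ℝ H) (ξ : H) (p q : Lp ℂ 2 μ) :
    ⟪sndEmbedding μ ι p, mulOp (omegaTensorOne μ e ξ) (sndEmbedding μ ι q)⟫_ℂ =
      (Real.exp (-‖ξ‖ ^ 2) : ℂ) * ⟪p, q⟫_ℂ := by
  rw [L2.inner_def, L2.inner_def, ← integral_omega e ξ, ← integral_prod_mul]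
  refine integral_congr_ae ?_
  filter_upwards [coeFn_mulOp (omegaTensorOne μ e ξ) (sndEmbedding μ ι q),
    sndEmbedding_ae (ι := ι) μ p, sndEmbedding_ae (ι := ι) μ q,
    coeFn_omegaTensorOne μ e ξ] with y h1 h2 h3 h4
  rw [h1, h2, h3, h4]
  simp only [RCLike.inner_apply]
  ring

variable [Group Γ]

theorem fibreProjection_traceVector :
    fibreProjection μ Γ ι (traceVector Γ ι μ) = traceVector Γ ι μ := by
  refine lp.ext (funext fun g => ?_)
  rw [fibreProjection_apply]
  by_cases hg : g = 1
  · subst hg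
    rw [traceVector_one, ← sndEmbedding_const, sndAdjoint_sndEmbedding]
  · rw [traceVector_of_ne μ hg, map_zero, map_zero]

variable [MulAction Γ X] [MeasurableConstSMul Γ X] [SMulInvariantMeasure Γ X μ]

/-- Integrating out the Gaussian variable is linear over `L^∞(X)`, and the same projection is used
on every fibre, so left translation commutes with it. -/
theorem fibreProjection_mem_commutant :
    fibreProjection μ Γ ι ∈ (smallAlgebra μ Γ ι).commutant := by
  refine mem_commutant_smallAlgebra μ (fun a => ?_) (fun h => ?_)
  · ext1 f
    refine lp.ext (funext fun g => ?_)
    change mulOp (oneTensor μ ι (translate μ g⁻¹ a)) (sndEmbedding μ ι (sndAdjoint μ ι (f g))) =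
      sndEmbedding μ ι (sndAdjoint μ ι (mulOp (oneTensor μ ι (translate μ g⁻¹ a)) (f g)))
    rw [sndAdjoint_mulOp, sndEmbedding_mulOp]
  · ext1 f
    refine lp.ext (funext fun g => ?_)
    rw [mul_apply_eq_comp, mul_apply_eq_comp, groupUnitary_apply, fibreProjection_apply,
      fibreProjection_apply, groupUnitary_apply]

/-- The Fourier coefficients of elements of `M` are functions on `X`. -/
theorem exists_sndEmbedding_of_mem_smallAlgebra {a : Op Γ ι μ} (ha : a ∈ smallAlgebra μ Γ ι)
    (g : Γ) : ∃ p : Lp ℂ 2 μ, a (traceVector Γ ι μ) g = sndEmbedding μ ι p := by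
  have h1 := congrArg (fun T : Op Γ ι μ => T (traceVector Γ ι μ))
    (VonNeumannAlgebra.mem_commutant_iff.1 (fibreProjection_mem_commutant μ) a ha)
  simp only [mul_apply_eq_comp, fibreProjection_traceVector] at h1
  rw [h1, fibreProjection_apply]
  exact ⟨_, rfl⟩

end BaseFactor

/-! ### The 2-norm estimate for the deformation -/

section MainEstimate

variable {K : Type*} [NormedAddCommGroup K] [InnerProductSpace ℂ K] [CompleteSpace K]

/-- The identity `Re τ(a x*) = Re τ(x* a)` for a unitary `x`. -/
theorem re_inner_mul_star_apply (N : VonNeumannAlgebra K) (Ω : K)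
    (htr : ∀ a ∈ N, ‖star a Ω‖ = ‖a Ω‖) {a x : K →L[ℂ] K} (ha : a ∈ N) (hx : x ∈ N)
    (hxu : x ∈ unitary (K →L[ℂ] K)) :
    (⟪Ω, (a * star x) Ω⟫_ℂ).re = (⟪x Ω, a Ω⟫_ℂ).re := by
  have hn : ∀ η, ‖x η‖ = ‖η‖ := fun η => ContinuousLinearMap.norm_map_of_mem_unitary hxu η
  have h1 : ∀ c ∈ N, ‖(c * star x) Ω‖ = ‖c Ω‖ := fun c hc => by
    rw [← htr (c * star x) (mul_mem hc (star_mem hx)), star_mul, star_star, mul_apply_eq_comp, hn,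
      htr c hc]
  -- Comparing `‖(a - x)x*Ω‖ = ‖(a - x)Ω‖` with `‖ax*Ω‖ = ‖aΩ‖`, and using `xx* = 1`, isolates the
  -- two real inner products.
  have h2 := h1 (a - x) (sub_mem ha hx)
  rw [sub_mul, (Unitary.mem_iff.1 hxu).2, sub_apply, sub_apply, one_apply_eq_self] at h2
  have h3 := norm_sub_sq (𝕜 := ℂ) ((a * star x) Ω) Ω
  have h4 := norm_sub_sq (𝕜 := ℂ) (a Ω) (x Ω)
  rw [h2, h1 a ha] at h3
  rw [h3, hn] at h4
  rw [← inner_conj_symm, Complex.conj_re, ← inner_conj_symm (x Ω), Complex.conj_re]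
  have h5 : RCLike.re ⟪(a * star x) Ω, Ω⟫_ℂ = RCLike.re ⟪a Ω, x Ω⟫_ℂ := by linarith
  exact h5

variable {Γ ι H X : Type*} [NormedAddCommGroup H] [InnerProductSpace ℝ H]
  [MeasurableSpace X] (μ : Measure X)

theorem re_inner_le_of_forall_re_inner_le {f f' h k : Space Γ ι μ}
    (hle : ∀ g, (⟪f g, h g⟫_ℂ).re ≤ ((⟪f g, f g⟫_ℂ).re + (⟪f' g, k g⟫_ℂ).re) / 2) :
    (⟪f, h⟫_ℂ).re ≤ ((⟪f, f⟫_ℂ).re + (⟪f', k⟫_ℂ).re) / 2 :=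
  hasSum_le hle (Complex.hasSum_re (lp.hasSum_inner f h))
    (((Complex.hasSum_re (lp.hasSum_inner f f)).add
      (Complex.hasSum_re (lp.hasSum_inner f' k))).div_const 2)

variable [Group Γ] [IsProbabilityMeasure μ]

theorem deformationOp_traceVector (e : HilbertBasis ι ℝ H) (b : Γ → H) (hb1 : b 1 = 0) (t : ℝ) :
    deformationOp μ e b t (traceVector Γ ι μ) = traceVector Γ ι μ := by
  refine lp.ext (funext fun g => ?_)
  rw [deformationOp, diagOp_apply]
  by_cases hg : g = 1
  · subst hg
    rw [inv_one, hb1, smul_zero, neg_zero, mulOp_eq_self (omegaTensorOne_zero μ e)]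
  · rw [traceVector_of_ne μ hg, map_zero]

/-- The implementing unitary fixes the trace vector since `b 1 = 0`, so `α_t` acts on the
coefficients of `x` through left multiplication alone. -/
theorem deformation_traceVector_apply (e : HilbertBasis ι ℝ H) (b : Γ → H) (hb1 : b 1 = 0) (t : ℝ)
    (x : Op Γ ι μ) (g : Γ) :
    deformation μ e b t x (traceVector Γ ι μ) g =
      mulOp (omegaTensorOne μ e (-(t • b g⁻¹))) (x (traceVector Γ ι μ) g) := by
  rw [deformation_apply, mul_apply_eq_comp, mul_apply_eq_comp,
    deformationOp_traceVector μ e b hb1, deformationOp, diagOp_apply]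

theorem trace_star_mul (x y : Op Γ ι μ) :
    trace (star x * y) = ⟪x (traceVector Γ ι μ), y (traceVector Γ ι μ)⟫_ℂ := by
  rw [trace, mul_apply_eq_comp, ContinuousLinearMap.star_eq_adjoint,
    ContinuousLinearMap.adjoint_inner_right]

variable [MulAction Γ X] [MeasurableConstSMul Γ X] [SMulInvariantMeasure Γ X μ]

/-- With `y = E_M(α_t(x))`, the defining property gives `‖yΩ‖² = ⟪yΩ, α_t(x)Ω⟫`. A fibrewise
inequality bounds this by `(‖yΩ‖² + Re⟪xΩ, α_t(x)Ω⟫)/2`, and `‖yΩ‖²` is absorbed. The coefficients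
of `y` need not be computed. -/
theorem norm2_condExp_le (e : HilbertBasis ι ℝ H) (b : Γ → H) (hb1 : b 1 = 0)
    (t : ℝ) {x : Op Γ ι μ} (hx : x ∈ smallAlgebra μ Γ ι) :
    norm2 (condExp (smallAlgebra μ Γ ι) (deformation μ e b t x)) ≤
      √(⟪x (traceVector Γ ι μ), deformation μ e b t x (traceVector Γ ι μ)⟫_ℂ).re := by
  set Ω := traceVector Γ ι μ with hΩ
  rw [condExp]
  split_ifs with hex
  · obtain ⟨hyM, hy⟩ := hex.choose_spec
    set y := hex.choose
    have h1 := hy (star y) (star_mem hyM)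
    rw [trace_star_mul, trace_star_mul] at h1
    refine Real.sqrt_le_sqrt ?_
    rw [trace_star_mul]
    have h2 := re_inner_le_of_forall_re_inner_le μ (f := y Ω) (f' := x Ω)
      (h := deformation μ e b t x Ω) (k := deformation μ e b t x Ω) fun g => by
        rw [deformation_traceVector_apply μ e b hb1]
        obtain ⟨p, hp⟩ := exists_sndEmbedding_of_mem_smallAlgebra μ hyM g
        obtain ⟨q, hq⟩ := exists_sndEmbedding_of_mem_smallAlgebra μ hx g
        rw [hp, hq, inner_sndEmbedding_omega, inner_sndEmbedding_omega,
          LinearIsometry.inner_map_map]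
        set c := Real.exp (-‖-(t • b g⁻¹)‖ ^ 2) with hc
        -- On this fibre the claim is `c Re⟪p, q⟫ ≤ (‖p‖² + c‖q‖²)/2`, which follows from `2c‖p‖‖q‖
        -- ≤ ‖p‖² + c²‖q‖²` and `c² ≤ c`.
        have hc0 : 0 < c := Real.exp_pos _
        have hc1 : c ≤ 1 := Real.exp_le_one_iff.2 (by nlinarith [sq_nonneg ‖-(t • b g⁻¹)‖])
        rw [Complex.re_ofReal_mul, Complex.re_ofReal_mul]
        have e1 : (⟪p, p⟫_ℂ).re = ‖p‖ ^ 2 := inner_self_eq_norm_sq (𝕜 := ℂ) p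
        have e2 : (⟪q, q⟫_ℂ).re = ‖q‖ ^ 2 := inner_self_eq_norm_sq (𝕜 := ℂ) q
        have e3 : (⟪p, q⟫_ℂ).re ≤ ‖p‖ * ‖q‖ := re_inner_le_norm (𝕜 := ℂ) p q
        rw [e1, e2]
        have e4 : c * (⟪p, q⟫_ℂ).re ≤ c * (‖p‖ * ‖q‖) := by gcongr
        have e5 : c * c * ‖q‖ ^ 2 ≤ 1 * c * ‖q‖ ^ 2 := by gcongr
        nlinarith [sq_nonneg (‖p‖ - c * ‖q‖)]
    rw [← hΩ, h1] at *
    linarith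
  -- If no expectation exists, `condExp` takes its default value `0` and the bound is trivial, so
  -- existence never has to be proved.
  · have h1 : norm2 (0 : Op Γ ι μ) = 0 := by
      rw [norm2, mul_zero, trace]
      simp
    rw [h1]
    exact Real.sqrt_nonneg _

end MainEstimate

end GaussianDeformation

end

theorem corollary3p4 {Γ ι H X : Type*} [Group Γ] [NormedAddCommGroup H] [InnerProductSpace ℝ H]
    [MeasurableSpace X] (μ : Measure X) [IsProbabilityMeasure μ]
    [MulAction Γ X] [MeasurableConstSMul Γ X] [SMulInvariantMeasure Γ X μ]
    (e : HilbertBasis ι ℝ H) (π : Γ →* (H ≃ₗᵢ[ℝ] H)) (b : Γ → H)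
    (hb : ∀ g h, b (g * h) = π g (b h) + b g)
    (Q : VonNeumannAlgebra (GaussianDeformation.Space Γ ι μ))
    (hQ : Q ≤ GaussianDeformation.smallAlgebra μ Γ ι)
    (δ t : ℝ) (hδ : 0 < δ)
    (h : ∀ x ∈ Q, x ∈ unitary (GaussianDeformation.Op Γ ι μ) →
      δ ≤ GaussianDeformation.norm2 (GaussianDeformation.condExp
        (GaussianDeformation.smallAlgebra μ Γ ι) (GaussianDeformation.deformation μ e b t x))) :
    ∃ v ∈ GaussianDeformation.bigAlgebra μ e π, v ≠ 0 ∧ v * star v * v = v ∧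
      ∀ x ∈ Q, GaussianDeformation.deformation μ e b t x * v = v * x := by
  have hb1 : b 1 = 0 := by simpa using hb 1 1
  set N := GaussianDeformation.bigAlgebra μ e π
  set Ω := GaussianDeformation.traceVector Γ ι μ
  have hQN : Q ≤ N := hQ.trans (GaussianDeformation.smallAlgebra_le_bigAlgebra μ e π)
  have hα : ∀ x ∈ Q, GaussianDeformation.deformation μ e b t x ∈ N := fun x hx =>
    GaussianDeformation.deformation_mem μ e π b hb t (hQN hx)
  have htr : ∀ a ∈ N, ‖star a Ω‖ = ‖a Ω‖ := fun a ha =>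
    GaussianDeformation.norm_star_apply_traceVector μ e π ha
  -- The constant `δ ^ 2` comes from squaring `δ ≤ ‖E_M(α_t(x))‖₂ ≤ √(Re τ(x* α_t(x)))`.
  refine GaussianDeformation.exists_partialIsometry_intertwiner_of_inner_ge N Q hQN Ω
    (GaussianDeformation.dense_commutant_traceVector μ e π) htr
    (GaussianDeformation.deformation μ e b t) hα (δ ^ 2) (by positivity) fun x hx hxu => ?_
  rw [GaussianDeformation.re_inner_mul_star_apply N Ω htr (hα x hx) (hQN hx) hxu]
  exact (Real.le_sqrt' hδ).1 ((h x hx hxu).trans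
    (GaussianDeformation.norm2_condExp_le μ e b hb1 t (hQ hx)))
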